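/- For a closed subgroup $H\le \mathrm{GL}(\mathbb R^d)$ let $G=\mathbb R^d\rtimes H$ carry the left Haar measure $dx\,\frac{dh}{|\det h|}$ ($dh$ a left Haar measure on $H$). For $x\in\mathbb R^d$, $g\in \mathrm{GL}(\mathbb R^d)$, $f\in L^2(\mathbb R^d)$ put $(\sigma(x,g)f)(y)=|\det g|^{-1/2}f(g^{-1}(y-x))$, and let $W_\chi f(x,h)=\langle f,\sigma(x,h)\chi\rangle_{L^2}$ for $(x,h)\in G$ be the wavelet transform. For a weight $w:H\to(0,\infty)$ let $L^1_w(G)$ be the space of measurable $F$ on $G$ with $\|F\|_{L^1_w}=\int_H\int_{\mathbb R^d}|F(x,h)|\,w(h)\,dx\,\frac{dh}{|\det h|}<\infty$. Let $v:H\to(0,\infty)$ be $v_0$-moderate, i.e. $v(ahb)\le v_0(a)v(h)v_0(b)$ for all $a,h,b\in H$, where $v_0:H\to(0,\infty)$ is measurable, locally bounded and submultiplicative. Write $u^+(h)=\max\{u(h),u(h^{-1})\}$ and let $w=v_0(1)\cdot v_0^+\cdot|\det|^+\cdot\Delta_H^+$ be the associated control weight ($\Delta_H$ the modular function of $H$).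 Let $\chi\ne0$ be an analyzing vector, i.e. $\chi \in \mathcal A_w=\{\chi\in L^2: W_\chi\chi\in L^1_w(G)\}$, and let $\mathcal H^1_w=\{u\in L^2: W_\chi u\in L^1_w(G)\}$ with norm $\|W_\chi u\|_{L^1_w}$. The coorbit space $\mathrm{Co}(L^1_v(G))$ is the set of all bounded antilinear functionals $F$ on $\mathcal H^1_w$ such that $W_\chi F:(x,h)\mapsto F(\sigma(x,h)\chi)$ belongs to $L^1_v(G)$. A function $f\in L^2(\mathbb R^d)$ is identified with the functional $u\mapsto\langle f,u\rangle_{L^2}$. Let $H_2=\left\{\varepsilon\begin{pmatrix}a&b\\0&a^{1/2}\end{pmatrix}: a>0,\ b\in\mathbb R,\ \varepsilon\in\{\pm1\}\right\}$ be the shearlet group, $v(h)=|\det h|^{7/6}$ on $H_2$, $g=\begin{pmatrix}0&-1\\1&0\end{pmatrix}$ the counter-clockwise rotation by $90^\circ$, and $g^{-1}vg:g^{-1}H_2g\to(0,\infty)$, $h\mapsto v(ghg^{-1})$. Let $\widehat f(\xi)=\int f(x)e^{-2\pi i\langle x,\xi\rangle}dx$. There exist $\varphi\in C_c^\infty(B_1((0,3)))$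 with $\varphi\ge0$ and $\varphi\equiv1$ on $B_{1/2}((0,3))$. For every such $\varphi$ there is a Schwartz function $\psi$ on $\mathbb R^2$ with $\widehat\psi=\varphi$ such that $$\psi\in \mathrm{Co}\big(L^1_{g^{-1}vg}(\mathbb R^2\rtimes g^{-1}H_2g)\big)\quad\text{and}\quad \psi\notin\mathrm{Co}\big(L^1_v(\mathbb R^2\rtimes H_2)\big).$$ Moreover $\mathrm{Co}(L^1_v(\mathbb R^2\rtimes H_2))$ is not invariant under rotation by $90^\circ$: there is $f\in L^2(\mathbb R^2)\cap\mathrm{Co}(L^1_v(\mathbb R^2\rtimes H_2))$ with $\sigma(0,g)f\notin\mathrm{Co}(L^1_v(\mathbb R^2\rtimes H_2))$. All these assertions hold for every admissible choice of $v_0$ and of the analyzing vector $\chi\neq 0$ in the definition of the respective coorbit space; for both groups such a $v_0$ exists, and for each of them $\mathcal A_w\neq\{0\}$. -/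

import Mathlib

open MeasureTheory FourierTransform SchwartzMap
open scoped ContDiff Matrix ENNReal

noncomputable section

namespace Coorbit

/-- Euclidean space `ℝ^d`. -/
abbrev E (d : ℕ) : Type := EuclideanSpace ℝ (Fin d)

/-- The Hilbert space `L²(ℝ^d)` of complex-valued functions. -/
abbrev L2 (d : ℕ) : Type := Lp ℂ 2 (volume : Measure (E d))

/-- `|det h|` for an invertible matrix `h`. -/
def absDet {d : ℕ} (h : GL (Fin d) ℝ) : ℝ := |(h : Matrix (Fin d) (Fin d) ℝ).det|

/-- The action `x ↦ h x` of a matrix on column vectors. -/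
def act {d : ℕ} (h : GL (Fin d) ℝ) (x : E d) : E d :=
  Matrix.toEuclideanLin (h : Matrix (Fin d) (Fin d) ℝ) x

/-! ### The quasi-regular representation -/

/-- `y ↦ |det g|^{-1/2} f (g⁻¹ (y - x))`. -/
def quasiRegularFun {d : ℕ} (x : E d) (g : GL (Fin d) ℝ) (f : E d → ℂ) (y : E d) : ℂ :=
  ((absDet g ^ (-(1 / 2) : ℝ) : ℝ) : ℂ) * f (act g⁻¹ (y - x))

lemma det_toEuclideanLin_ne_zero {d : ℕ} (g : GL (Fin d) ℝ) :
    LinearMap.det (Matrix.toEuclideanLin (g : Matrix (Fin d) (Fin d) ℝ)) ≠ 0 := by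
  have h : Matrix.toEuclideanLin (g : Matrix (Fin d) (Fin d) ℝ) ∘ₗ
      Matrix.toEuclideanLin ((g⁻¹ : GL (Fin d) ℝ) : Matrix (Fin d) (Fin d) ℝ) = LinearMap.id := by
    ext x i
    simp [Matrix.toLpLin_apply]
  intro h0
  have h1 := congrArg LinearMap.det h
  rw [LinearMap.det_comp, h0, zero_mul, LinearMap.det_id] at h1
  exact zero_ne_one h1

lemma memLp_quasiRegularFun {d : ℕ} (x : E d) (g : GL (Fin d) ℝ) {f : E d → ℂ}
    (hf : MemLp f 2 volume) : MemLp (quasiRegularFun x g f) 2 volume := by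
  have h1 : MemLp (fun y => f (act g⁻¹ y)) 2 volume := by
    have hm : Measurable (act (g⁻¹) : E d → E d) :=
      (LinearMap.continuous_of_finiteDimensional
        (Matrix.toEuclideanLin ((g⁻¹ : GL (Fin d) ℝ) : Matrix (Fin d) (Fin d) ℝ))).measurable
    have hmap : Measure.map (act (g⁻¹) : E d → E d) volume =
        ENNReal.ofReal |(LinearMap.det (Matrix.toEuclideanLin
          ((g⁻¹ : GL (Fin d) ℝ) : Matrix (Fin d) (Fin d) ℝ)))⁻¹| • volume :=
      Measure.map_linearMap_addHaar_eq_smul_addHaar volume (det_toEuclideanLin_ne_zero g⁻¹)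
    have h2 : MemLp f 2 (Measure.map (act (g⁻¹) : E d → E d) volume) := by
      rw [hmap]; exact hf.smul_measure ENNReal.ofReal_ne_top
    exact h2.comp_of_map hm.aemeasurable
  have h3 : MemLp (fun y => f (act g⁻¹ (y - x))) 2 volume :=
    h1.comp_measurePreserving (measurePreserving_sub_right volume x)
  exact h3.const_mul _

/-- The quasi-regular representation of the affine group on `L²(ℝ^d)`:
`(σ(x, g) f)(y) = |det g|^{-1/2} f (g⁻¹ (y - x))`. -/
def quasiRegular {d : ℕ} (x : E d) (g : GL (Fin d) ℝ) (f : L2 d) : L2 d :=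
  (memLp_quasiRegularFun x g (Lp.memLp f)).toLp (quasiRegularFun x g f)

/-! ### Matrix groups as locally compact groups with their Borel structure -/

instance measurableSpaceGL {d : ℕ} : MeasurableSpace (GL (Fin d) ℝ) := borel _

instance borelSpaceGL {d : ℕ} : BorelSpace (GL (Fin d) ℝ) := ⟨rfl⟩

instance locallyCompactGL {d : ℕ} : LocallyCompactSpace (GL (Fin d) ℝ) := by
  have : LocallyCompactSpace (Matrix (Fin d) (Fin d) ℝ) :=
    inferInstanceAs (LocallyCompactSpace (Fin d → Fin d → ℝ))
  infer_instance

section General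

variable {d : ℕ} (H : Subgroup (GL (Fin d) ℝ))

/-- The conjugated group `g⁻¹ H g`, i.e. the group of all `h` with `g h g⁻¹ ∈ H`. -/
def conjGroup (g : GL (Fin d) ℝ) : Subgroup (GL (Fin d) ℝ) :=
  H.comap (MulAut.conj g).toMonoidHom

/-- The conjugated weight `h ↦ v (g h g⁻¹)` on `g⁻¹ H g`. -/
def conjWeight (g : GL (Fin d) ℝ) (v : H → ℝ) : conjGroup H g → ℝ :=
  fun h => v ⟨g * h * g⁻¹, h.2⟩

/-- `v₀` is a positive, measurable, locally bounded, submultiplicative weight and `v` is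
`v₀`-moderate. -/
structure IsModerate (v v₀ : H → ℝ) : Prop where
  pos : ∀ h, 0 < v₀ h
  measurable : Measurable v₀
  bounded_on_compact : ∀ K : Set H, IsCompact K → ∃ C, ∀ h ∈ K, v₀ h ≤ C
  submultiplicative : ∀ h k, v₀ (h * k) ≤ v₀ h * v₀ k
  moderate : ∀ a h b, v (a * h * b) ≤ v₀ a * v h * v₀ b

variable [LocallyCompactSpace H]

/-- The left Haar measure `dx dh / |det h|` on `G = ℝ^d ⋊ H`, where `dh` is left Haar measure
on `H`. -/
def haarSemidirect : Measure (E d × H) :=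
  (volume : Measure (E d)).prod
    ((Measure.haar : Measure H).withDensity fun h => ENNReal.ofReal (absDet (h : GL (Fin d) ℝ))⁻¹)

/-- Membership in `L¹_w(G)` for a weight `w` depending only on the second variable. -/
def MemWeightedL1 (w : H → ℝ) (F : E d × H → ℂ) : Prop :=
  Integrable (fun p => (w p.2 : ℂ) * F p) (haarSemidirect H)

/-- The norm of `L¹_w(G)`. -/
def weightedL1Norm (w : H → ℝ) (F : E d × H → ℂ) : ℝ :=
  ∫ p, ‖(w p.2 : ℂ) * F p‖ ∂(haarSemidirect H)

/-- The wavelet transform `W_χ f (x, h) = ⟨f, σ(x, h) χ⟩` on `G`. The inner product of the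
library is antilinear in its first argument. -/
def waveletTransform (χ f : L2 d) : E d × H → ℂ :=
  fun p => inner ℂ (quasiRegular p.1 (p.2 : GL (Fin d) ℝ) χ) f

/-- The set `A_w` of analyzing vectors. -/
def analyzingVectors (w : H → ℝ) : Set (L2 d) :=
  {χ | MemWeightedL1 H w (waveletTransform H χ χ)}

/-- The space `H¹_w = {f ∈ L² : W_χ f ∈ L¹_w(G)}` for a fixed `χ`. -/
def H1w (w : H → ℝ) (χ : L2 d) : Submodule ℂ (L2 d) where
  carrier := {f | MemWeightedL1 H w (waveletTransform H χ f)}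
  zero_mem' := by
    simp [MemWeightedL1, waveletTransform]
  add_mem' := by
    intro f g hf hg
    have := Integrable.add hf hg
    refine this.congr (Filter.Eventually.of_forall fun p => ?_)
    simp [waveletTransform, inner_add_right, mul_add]
  smul_mem' := by
    intro c f hf
    have := Integrable.const_mul hf c
    refine this.congr (Filter.Eventually.of_forall fun p => ?_)
    simp only [waveletTransform, inner_smul_right]
    ring

/-- The reservoir: antilinear functionals on `H¹_w` that are bounded for the norm
`‖f‖ = ‖W_χ f‖_{L¹_w(G)}`. -/
def reservoir (w : H → ℝ) (χ : L2 d) : Set (H1w H w χ →ₛₗ[starRingEnd ℂ] ℂ) :=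
  {F | ∃ C : ℝ, ∀ u : H1w H w χ,
    ‖F u‖ ≤ C * weightedL1Norm H w (waveletTransform H χ (u : L2 d))}

open Classical in
/-- The extended wavelet transform `W_χ F (x, h) = F (σ(x, h) χ)` of an antilinear functional `F`
on `H¹_w`. If `χ` is an analyzing vector and `w` is submultiplicative, then `σ(x, h) χ` lies in
`H¹_w` for all `(x, h)`, so that the second branch does not occur. -/
def extendedWaveletTransform (w : H → ℝ) (χ : L2 d) (F : H1w H w χ →ₛₗ[starRingEnd ℂ] ℂ) :
    E d × H → ℂ :=
  fun p =>
    if hp : quasiRegular p.1 (p.2 : GL (Fin d) ℝ) χ ∈ H1w H w χ then F ⟨_, hp⟩ else 0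

/-- The coorbit space `Co(L¹_v(G))`, formed with the control weight `w` and the analyzing
vector `χ`. -/
def coorbitSpace (v w : H → ℝ) (χ : L2 d) : Set (H1w H w χ →ₛₗ[starRingEnd ℂ] ℂ) :=
  {F | F ∈ reservoir H w χ ∧ MemWeightedL1 H v (extendedWaveletTransform H w χ F)}

/-- `f ∈ L²(ℝ^d)` belongs to `Co(L¹_v(G))`, where `f` is identified with the antilinear
functional `u ↦ ⟨f, u⟩` on `H¹_w`. -/
def MemCoorbit (v w : H → ℝ) (χ f : L2 d) : Prop :=
  ∃ F ∈ coorbitSpace H v w χ, ∀ u : H1w H w χ, F u = inner ℂ (u : L2 d) f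

/-- The modular function of `H`. Only its symmetrization `max (Δ h) (Δ h⁻¹)` is used, which is the
same for both conventions found in the literature. -/
def modularFun (h : H) : ℝ := (Measure.modularCharacterFun h : ℝ)

/-- The control weight `v₀(1) · v₀⁺ · |det|⁺ · Δ_H⁺`, where `u⁺(h) = max (u h) (u h⁻¹)`. -/
def controlWeight (v₀ : H → ℝ) (h : H) : ℝ :=
  v₀ 1 * max (v₀ h) (v₀ h⁻¹) *
    max (absDet (h : GL (Fin d) ℝ)) (absDet ((h⁻¹ : H) : GL (Fin d) ℝ)) *
    max (modularFun H h) (modularFun H h⁻¹)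

end General

/-! ### The shearlet group and the rotation by 90 degrees -/

/-- The shearlet group: all matrices `ε [[a, b], [0, a^{1/2}]]` with `a > 0`, `b` real and
`ε = ± 1`. -/
def shearletGroup : Subgroup (GL (Fin 2) ℝ) where
  carrier := {h | ∃ a b ε : ℝ, 0 < a ∧ (ε = 1 ∨ ε = -1) ∧
    (h : Matrix (Fin 2) (Fin 2) ℝ) = ε • !![a, b; 0, Real.sqrt a]}
  one_mem' := ⟨1, 0, 1, one_pos, Or.inl rfl, by simp [Matrix.one_fin_two]⟩
  mul_mem' := by
    rintro h k ⟨a, b, ε, ha, hε, hh⟩ ⟨a', b', ε', ha', hε', hk⟩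
    refine ⟨a * a', a * b' + b * Real.sqrt a', ε * ε', mul_pos ha ha', ?_, ?_⟩
    · rcases hε with rfl | rfl <;> rcases hε' with rfl | rfl <;> norm_num
    · rw [Units.val_mul, hh, hk, Real.sqrt_mul ha.le]
      ext i j
      fin_cases i <;> fin_cases j <;> simp [Matrix.mul_apply, Fin.sum_univ_two] <;> ring
  inv_mem' := by
    rintro h ⟨a, b, ε, ha, hε, hh⟩
    have hs : Real.sqrt a ≠ 0 := (Real.sqrt_pos.2 ha).ne'
    refine ⟨a⁻¹, -(b / (a * Real.sqrt a)), ε, inv_pos.2 ha, hε, ?_⟩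
    rw [Matrix.coe_units_inv]
    refine Matrix.inv_eq_right_inv ?_
    have hε2 : ε * ε = 1 := by rcases hε with rfl | rfl <;> norm_num
    rw [hh, Matrix.smul_mul, Matrix.mul_smul, smul_smul, hε2, one_smul, Real.sqrt_inv]
    ext i j
    fin_cases i <;> fin_cases j <;> simp [Matrix.mul_apply, Fin.sum_univ_two] <;> field_simp
    ring

lemma mem_shearletGroup_iff (h : GL (Fin 2) ℝ) :
    h ∈ shearletGroup ↔ h 1 0 = 0 ∧ h 0 0 = h 1 1 * |h 1 1| := by
  constructor
  · rintro ⟨a, b, ε, ha, hε, hh⟩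
    have hs : Real.sqrt a * Real.sqrt a = a := Real.mul_self_sqrt ha.le
    rcases hε with rfl | rfl <;> simp [hh, abs_of_nonneg, Real.sqrt_nonneg, hs]
  · rintro ⟨h10, h00⟩
    have hdet : (h : Matrix (Fin 2) (Fin 2) ℝ).det ≠ 0 :=
      ((Matrix.isUnit_iff_isUnit_det _).1 h.isUnit).ne_zero
    have h11 : h 1 1 ≠ 0 := by
      intro h0
      apply hdet
      rw [Matrix.det_fin_two, h10, h0]; ring
    rcases lt_or_gt_of_ne h11 with hneg | hpos
    · refine ⟨h 1 1 ^ 2, - h 0 1, -1, by positivity, Or.inr rfl, ?_⟩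
      rw [abs_of_neg hneg] at h00
      ext i j
      fin_cases i <;> fin_cases j <;> simp [h00, h10, Real.sqrt_sq_eq_abs, abs_of_neg hneg]
      ring
    · refine ⟨h 1 1 ^ 2, h 0 1, 1, by positivity, Or.inl rfl, ?_⟩
      rw [abs_of_pos hpos] at h00
      ext i j
      fin_cases i <;> fin_cases j <;> simp [h00, h10, Real.sqrt_sq_eq_abs, abs_of_pos hpos]
      ring

lemma isClosed_shearletGroup : IsClosed (shearletGroup : Set (GL (Fin 2) ℝ)) := by
  have hc : ∀ i j, Continuous fun h : GL (Fin 2) ℝ => h i j := fun i j =>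
    Units.continuous_val.matrix_elem i j
  have he : (shearletGroup : Set (GL (Fin 2) ℝ)) =
      {h | h 1 0 = 0} ∩ {h | h 0 0 = h 1 1 * |h 1 1|} := by
    ext h; exact mem_shearletGroup_iff h
  rw [he]
  exact (isClosed_eq (hc 1 0) continuous_const).inter
    (isClosed_eq (hc 0 0) ((hc 1 1).mul (hc 1 1).abs))

lemma isClosed_conjGroup (g : GL (Fin 2) ℝ) :
    IsClosed (conjGroup shearletGroup g : Set (GL (Fin 2) ℝ)) :=
  isClosed_shearletGroup.preimage
    (by fun_prop : Continuous fun h : GL (Fin 2) ℝ => g * h * g⁻¹)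

instance locallyCompactShearlet : LocallyCompactSpace shearletGroup :=
  isClosed_shearletGroup.isClosedEmbedding_subtypeVal.locallyCompactSpace

instance locallyCompactConj (g : GL (Fin 2) ℝ) :
    LocallyCompactSpace (conjGroup shearletGroup g) :=
  (isClosed_conjGroup g).isClosedEmbedding_subtypeVal.locallyCompactSpace

/-- The weight `v(h) = |det h|^{7/6}` on the shearlet group. -/
def shearletWeight (h : shearletGroup) : ℝ := absDet (h : GL (Fin 2) ℝ) ^ (7 / 6 : ℝ)

/-- The counter-clockwise rotation by 90 degrees. -/
def rot : GL (Fin 2) ℝ :=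
  Matrix.GeneralLinearGroup.mkOfDetNeZero !![0, -1; 1, 0] (by simp [Matrix.det_fin_two])

/-- `φ` is a nonnegative smooth function with compact support in the open unit ball around
`(0, 3)` that equals `1` on the ball of radius `1/2` around `(0, 3)`. -/
structure IsBumpAtBlindSpot (φ : E 2 → ℝ) : Prop where
  smooth : ContDiff ℝ ∞ φ
  compact_support : HasCompactSupport φ
  support_subset : tsupport φ ⊆ Metric.ball !₂[(0 : ℝ), 3] 1
  nonneg : ∀ ξ, 0 ≤ φ ξ
  eq_one : ∀ ξ ∈ Metric.ball (!₂[(0 : ℝ), 3] : E 2) (1 / 2), φ ξ = 1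

end Coorbit

end

open Coorbit

open MeasureTheory FourierTransform SchwartzMap
open scoped ContDiff Matrix ENNReal

noncomputable section

/-! On the Fourier side `σ(x, h)` is modulation by `x` combined with the substitution `ξ ↦ hᵀξ`. For
the shearlet group this dual action has one open conull orbit `O = {ξ 0 ≠ 0}`, on which the group
acts freely; `h ↦ hᵀ(1, 0)` is a homeomorphism onto it. The vertical axis, which is left out, is the
blind spot of the group. Conjugating by the rotation moves the blind spot to the horizontal axis.
The bump `φ` crosses the vertical axis and stays away from the horizontal one; this asymmetry is the
whole theorem.

Membership. If `η̂` and `ψ̂` have compact support in `O`, properness of the dual action confines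
`W_η ψ` to a compact set of `h`, so it lies in every `L¹_w` with a measurable, locally bounded
weight. To reach an arbitrary analyzing vector `χ`, use the orthogonality relation `∫ ⟨W_χ f, W_η g⟩
= ⟨f, g⟩ C(χ, η)` (`IsFreeOpenOrbit.integral_inner_waveletTransform`). It holds for all `χ, f ∈ L²`
as soon as `η, g` are bandlimited, and for `χ ≠ 0` some bandlimited `η` has `C(χ, η) ≠ 0`
(`IsFreeOpenOrbit.exists_orbitPairing_ne_zero`). It yields the pointwise bounds `|C| |W_χ ψ| ≤ |W_η
ψ| * |W_χ χ|` and `|C| |W_η f| ≤ |W_χ f| * |W_η η|`, and the weighted Young inequality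
`lintegral_convolution_le` turns them into change-of-window statements. The first gives
`IsFreeOpenOrbit.memCoorbit`; the second, `IsFreeOpenOrbit.exists_bandlimited_of_memCoorbit`,
reduces non-membership to a bandlimited window.

Non-membership. In the translation variable `W_η ψ(·, h)` has Fourier transform `|det h|^{1/2}
ψ̂(ξ)` times the conjugate of `η̂(hᵀξ)`, and an `L¹` norm dominates the supremum of the Fourier
transform. Fix `ξ ∈ O` with `ψ̂(ξ) = 1`, write `ξ = s(ξ)ᵀ(1, 0)` and integrate over `h`: left
invariance of Haar measure gives `‖W_η ψ‖ ≥ D |det s(ξ)|^{1/2 - r}` for the weight `|det|^r`, where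
`D > 0` does not depend on `ξ`. Since `|det s(ξ)| = |ξ 0|^{3/2}`, letting `ξ` approach the blind
spot inside `{φ = 1}` makes the bound infinite whenever `r > 1/2`, in particular for `r = 7/6`.

Rotating `ψ` backwards puts its frequency support into `O`, so the rotated function is in the space
while `ψ` is not. -/

namespace Coorbit

/-! ### Linear action on Euclidean space, transposes and determinants -/

section Linear

variable {d : ℕ}

lemma act_apply (h : GL (Fin d) ℝ) (x : E d) :
    act h x = WithLp.toLp 2 ((h : Matrix (Fin d) (Fin d) ℝ) *ᵥ x.ofLp) := by
  simp [act, Matrix.toLpLin_apply]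

lemma act_one (x : E d) : act 1 x = x := by simp [act_apply]

lemma act_mul (h k : GL (Fin d) ℝ) (x : E d) : act (h * k) x = act h (act k x) := by
  simp [act_apply]

lemma act_inv_act (h : GL (Fin d) ℝ) (x : E d) : act h⁻¹ (act h x) = x := by
  rw [← act_mul, inv_mul_cancel, act_one]

lemma act_act_inv (h : GL (Fin d) ℝ) (x : E d) : act h (act h⁻¹ x) = x := by
  rw [← act_mul, mul_inv_cancel, act_one]

lemma act_add (h : GL (Fin d) ℝ) (x y : E d) : act h (x + y) = act h x + act h y := map_add _ _ _

lemma act_sub (h : GL (Fin d) ℝ) (x y : E d) : act h (x - y) = act h x - act h y := map_sub _ _ _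

lemma act_neg (h : GL (Fin d) ℝ) (x : E d) : act h (-x) = -act h x := map_neg _ _

lemma act_zero (h : GL (Fin d) ℝ) : act h (0 : E d) = 0 := map_zero _

lemma continuous_act_uncurry : Continuous fun p : GL (Fin d) ℝ × E d => act p.1 p.2 := by
  simp_rw [act_apply]
  exact (PiLp.continuous_toLp 2 _).comp
    ((Units.continuous_val.comp continuous_fst).matrix_mulVec
      ((PiLp.continuous_ofLp 2 _).comp continuous_snd))

@[fun_prop]
lemma Continuous.act {X : Type*} [TopologicalSpace X] {h : X → GL (Fin d) ℝ} {x : X → E d}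
    (hh : Continuous h) (hx : Continuous x) : Continuous fun t => Coorbit.act (h t) (x t) :=
  continuous_act_uncurry.comp (hh.prodMk hx)

lemma continuous_act (h : GL (Fin d) ℝ) : Continuous (act h : E d → E d) := by fun_prop

/-- A matrix acting on column vectors, as a homeomorphism. -/
def actHomeomorph (h : GL (Fin d) ℝ) : E d ≃ₜ E d where
  toFun := act h
  invFun := act h⁻¹
  left_inv := act_inv_act h
  right_inv := act_act_inv h
  continuous_toFun := continuous_act h
  continuous_invFun := continuous_act h⁻¹

lemma measurableEmbedding_act (h : GL (Fin d) ℝ) : MeasurableEmbedding (act h : E d → E d) :=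
  (actHomeomorph h).measurableEmbedding

/-- The transpose of an invertible matrix. -/
def transposeGL (h : GL (Fin d) ℝ) : GL (Fin d) ℝ where
  val := (h : Matrix (Fin d) (Fin d) ℝ)ᵀ
  inv := ((h⁻¹ : GL (Fin d) ℝ) : Matrix (Fin d) (Fin d) ℝ)ᵀ
  val_inv := by rw [← Matrix.transpose_mul, ← Units.val_mul, inv_mul_cancel]; simp
  inv_val := by rw [← Matrix.transpose_mul, ← Units.val_mul, mul_inv_cancel]; simp

lemma coe_transposeGL (h : GL (Fin d) ℝ) :
    (transposeGL h : Matrix (Fin d) (Fin d) ℝ) = (h : Matrix (Fin d) (Fin d) ℝ)ᵀ := rfl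

lemma transposeGL_mul (h k : GL (Fin d) ℝ) :
    transposeGL (h * k) = transposeGL k * transposeGL h := by
  ext1; simp [coe_transposeGL]

lemma transposeGL_inv (h : GL (Fin d) ℝ) : transposeGL h⁻¹ = (transposeGL h)⁻¹ := rfl

lemma transposeGL_one : transposeGL (1 : GL (Fin d) ℝ) = 1 := by ext1; simp [coe_transposeGL]

@[fun_prop]
lemma continuous_transposeGL : Continuous (transposeGL : GL (Fin d) ℝ → GL (Fin d) ℝ) :=
  Units.continuous_iff.2 ⟨Units.continuous_val.matrix_transpose,
    Units.continuous_coe_inv.matrix_transpose⟩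

lemma inner_act (h : GL (Fin d) ℝ) (x y : E d) :
    inner ℝ (act h x) y = inner ℝ x (act (transposeGL h) y) := by
  simp only [act_apply, coe_transposeGL, EuclideanSpace.inner_eq_star_dotProduct, star_trivial]
  rw [Matrix.mulVec_transpose, ← Matrix.dotProduct_mulVec]

lemma absDet_pos (h : GL (Fin d) ℝ) : 0 < absDet h :=
  abs_pos.2 ((Matrix.isUnit_iff_isUnit_det _).1 h.isUnit).ne_zero

lemma absDet_mul (h k : GL (Fin d) ℝ) : absDet (h * k) = absDet h * absDet k := by
  simp [absDet, abs_mul]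

lemma absDet_one : absDet (1 : GL (Fin d) ℝ) = 1 := by simp [absDet]

lemma absDet_inv (h : GL (Fin d) ℝ) : absDet h⁻¹ = (absDet h)⁻¹ := by
  refine eq_inv_of_mul_eq_one_left ?_
  rw [← absDet_mul, inv_mul_cancel, absDet_one]

lemma absDet_transposeGL (h : GL (Fin d) ℝ) : absDet (transposeGL h) = absDet h := by
  simp [absDet, coe_transposeGL]

@[fun_prop]
lemma continuous_absDet : Continuous (absDet : GL (Fin d) ℝ → ℝ) :=
  (Units.continuous_val.matrix_det).abs

lemma map_act_volume (h : GL (Fin d) ℝ) :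
    Measure.map (act h : E d → E d) volume = ENNReal.ofReal (absDet h)⁻¹ • volume := by
  have h1 := Measure.map_linearMap_addHaar_eq_smul_addHaar (volume : Measure (E d))
    (det_toEuclideanLin_ne_zero h)
  have h2 : LinearMap.det (Matrix.toEuclideanLin (h : Matrix (Fin d) (Fin d) ℝ)) =
      (h : Matrix (Fin d) (Fin d) ℝ).det := by
    rw [Matrix.toEuclideanLin_eq_toLin_orthonormal, LinearMap.det_toLin]
  rw [h2, abs_inv] at h1
  exact h1

lemma lintegral_comp_act (h : GL (Fin d) ℝ) (F : E d → ℝ≥0∞) :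
    ∫⁻ x, F (act h x) = ENNReal.ofReal (absDet h)⁻¹ * ∫⁻ x, F x := by
  rw [← (measurableEmbedding_act h).lintegral_map, map_act_volume, lintegral_smul_measure,
    smul_eq_mul]

lemma integral_comp_act (h : GL (Fin d) ℝ) (F : E d → ℂ) :
    ∫ x, F (act h x) = (absDet h)⁻¹ • ∫ x, F x := by
  rw [← (measurableEmbedding_act h).integral_map, map_act_volume, integral_smul_measure,
    ENNReal.toReal_ofReal (inv_pos.2 (absDet_pos h)).le]

lemma quasiMeasurePreserving_act (h : GL (Fin d) ℝ) :
    Measure.QuasiMeasurePreserving (act h : E d → E d) := by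
  refine ⟨(continuous_act h).measurable, ?_⟩
  rw [map_act_volume]
  exact Measure.smul_absolutelyContinuous

end Linear

/-- Second countability makes Haar measure σ-finite and lets continuous functions on products be
measurable for the product σ-algebra; every use of Fubini below relies on it. -/
instance secondCountableTopologyGL {d : ℕ} : SecondCountableTopology (GL (Fin d) ℝ) := by
  have : SecondCountableTopology (Matrix (Fin d) (Fin d) ℝ) :=
    inferInstanceAs (SecondCountableTopology (Fin d → Fin d → ℝ))
  have : SecondCountableTopology (Matrix (Fin d) (Fin d) ℝ)ᵐᵒᵖ :=
    MulOpposite.opHomeomorph.symm.secondCountableTopology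
  exact Units.isEmbedding_embedProduct.secondCountableTopology

instance secondCountableTopologySubgroup {d : ℕ} (H : Subgroup (GL (Fin d) ℝ)) :
    SecondCountableTopology H :=
  Topology.IsEmbedding.subtypeVal.secondCountableTopology

/-! ### The quasi-regular representation is isometric and multiplicative -/

section Representation

variable {d : ℕ}

lemma quasiRegularFun_congr (x : E d) (g : GL (Fin d) ℝ) {f f' : E d → ℂ}
    (h : f =ᵐ[volume] f') : quasiRegularFun x g f =ᵐ[volume] quasiRegularFun x g f' := by
  have h1 : (fun y => f (act g⁻¹ (y - x))) =ᵐ[volume] fun y => f' (act g⁻¹ (y - x)) :=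
    ((quasiMeasurePreserving_act g⁻¹).comp
      (measurePreserving_sub_right volume x).quasiMeasurePreserving).ae_eq_comp h
  filter_upwards [h1] with y hy
  simp only [quasiRegularFun, hy]

lemma coeFn_quasiRegular (x : E d) (g : GL (Fin d) ℝ) (f : L2 d) :
    quasiRegular x g f =ᵐ[volume] quasiRegularFun x g f :=
  MemLp.coeFn_toLp _

lemma quasiRegular_toLp (x : E d) (g : GL (Fin d) ℝ) {f : E d → ℂ} (hf : MemLp f 2 volume) :
    quasiRegular x g (hf.toLp f) =
      (memLp_quasiRegularFun x g hf).toLp (quasiRegularFun x g f) := by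
  refine Lp.ext ((coeFn_quasiRegular _ _ _).trans ?_)
  exact (quasiRegularFun_congr x g hf.coeFn_toLp).trans (MemLp.coeFn_toLp _).symm

lemma absDet_rpow_half_mul_self (g : GL (Fin d) ℝ) :
    absDet g ^ (-(1 / 2) : ℝ) * absDet g ^ (-(1 / 2) : ℝ) = (absDet g)⁻¹ := by
  rw [← Real.rpow_add (absDet_pos g), ← Real.rpow_neg_one]; norm_num

lemma inner_quasiRegular (x : E d) (g : GL (Fin d) ℝ) (f f' : L2 d) :
    inner ℂ (quasiRegular x g f) (quasiRegular x g f') = inner ℂ f f' := by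
  rw [L2.inner_def, L2.inner_def]
  have h1 : ∫ y, inner ℂ (quasiRegular x g f y) (quasiRegular x g f' y) =
      ∫ y, (fun u => ((absDet g)⁻¹ : ℝ) • inner ℂ (f (act g⁻¹ u)) (f' (act g⁻¹ u))) (y - x) := by
    refine integral_congr_ae ?_
    filter_upwards [coeFn_quasiRegular x g f, coeFn_quasiRegular x g f'] with y hy hy'
    rw [hy, hy', ← absDet_rpow_half_mul_self]
    simp only [quasiRegularFun, RCLike.inner_apply, map_mul, Complex.conj_ofReal,
      Complex.real_smul, Complex.ofReal_mul]
    ring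
  rw [h1, integral_sub_right_eq_self
    (fun u => ((absDet g)⁻¹ : ℝ) • inner ℂ (f (act g⁻¹ u)) (f' (act g⁻¹ u))) x,
    integral_smul, integral_comp_act g⁻¹ (fun u => inner ℂ (f u) (f' u)), smul_smul, absDet_inv,
    inv_inv, inv_mul_cancel₀ (absDet_pos g).ne', one_smul]

/-- The operators of the quasi-regular representation as linear isometries. -/
def quasiRegularₗᵢ (x : E d) (g : GL (Fin d) ℝ) : L2 d →ₗᵢ[ℂ] L2 d :=
  LinearMap.isometryOfInner
    { toFun := quasiRegular x g
      map_add' := by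
        intro f f'
        refine Lp.ext ((coeFn_quasiRegular _ _ _).trans ?_)
        filter_upwards [quasiRegularFun_congr x g (Lp.coeFn_add f f'), coeFn_quasiRegular x g f,
          coeFn_quasiRegular x g f', Lp.coeFn_add (quasiRegular x g f) (quasiRegular x g f')]
          with y h1 h2 h3 h4
        rw [h1, h4, Pi.add_apply, h2, h3]
        simp [quasiRegularFun, mul_add]
      map_smul' := by
        intro c f
        refine Lp.ext ((coeFn_quasiRegular _ _ _).trans ?_)
        filter_upwards [quasiRegularFun_congr x g (Lp.coeFn_smul c f), coeFn_quasiRegular x g f,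
          Lp.coeFn_smul c (quasiRegular x g f)] with y h1 h2 h4
        rw [h1, RingHom.id_apply, h4, Pi.smul_apply, h2]
        simp only [quasiRegularFun, Pi.smul_apply, smul_eq_mul]
        ring }
    (inner_quasiRegular x g)

lemma quasiRegular_quasiRegular (x y : E d) (g k : GL (Fin d) ℝ) (f : L2 d) :
    quasiRegular x g (quasiRegular y k f) = quasiRegular (x + act g y) (g * k) f := by
  refine Lp.ext ((coeFn_quasiRegular _ _ _).trans ?_)
  filter_upwards [quasiRegularFun_congr x g (coeFn_quasiRegular y k f),
    coeFn_quasiRegular (x + act g y) (g * k) f] with z h1 h2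
  rw [h1, h2]
  have h3 : act g⁻¹ (z - x) - y = act g⁻¹ (z - (x + act g y)) := by
    rw [← sub_sub, act_sub g⁻¹ _ (act g y), act_inv_act]
  simp only [quasiRegularFun, mul_inv_rev, act_mul, h3, absDet_mul,
    Real.mul_rpow (absDet_pos g).le (absDet_pos k).le, Complex.ofReal_mul]
  ring

lemma quasiRegular_zero_one (f : L2 d) : quasiRegular 0 1 f = f := by
  refine Lp.ext ((coeFn_quasiRegular _ _ _).trans (Filter.Eventually.of_forall fun y => ?_))
  simp [quasiRegularFun, act_one, absDet_one]

end Representation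

/-! ### The semidirect product and left invariance of its measure -/

section Semidirect

variable {d : ℕ} {H : Subgroup (GL (Fin d) ℝ)}

/-- The product of the semidirect product `ℝ^d ⋊ H`. -/
def gmul (p q : E d × H) : E d × H := (p.1 + act (p.2 : GL (Fin d) ℝ) q.1, p.2 * q.2)

/-- The inverse of the semidirect product `ℝ^d ⋊ H`. -/
def ginv (p : E d × H) : E d × H := (-act ((p.2 : GL (Fin d) ℝ)⁻¹) p.1, p.2⁻¹)

lemma gmul_ginv_cancel_left (p q : E d × H) : gmul p (gmul (ginv p) q) = q := by
  ext1 <;> simp [gmul, ginv, act_add, act_neg, act_act_inv]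

lemma ginv_gmul_cancel_left (p q : E d × H) : gmul (ginv p) (gmul p q) = q := by
  ext1 <;> simp [gmul, ginv, act_add, act_inv_act]

/-- The quasi-regular representation of `ℝ^d ⋊ H`. -/
abbrev rep (p : E d × H) (f : L2 d) : L2 d := quasiRegular p.1 (p.2 : GL (Fin d) ℝ) f

lemma rep_rep (p q : E d × H) (f : L2 d) : rep p (rep q f) = rep (gmul p q) f :=
  quasiRegular_quasiRegular _ _ _ _ _

lemma rep_ginv_rep (p : E d × H) (f : L2 d) : rep (ginv p) (rep p f) = f := by
  rw [rep_rep]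
  have : gmul (ginv p) p = (0, 1) := by ext1 <;> simp [gmul, ginv]
  rw [this]
  exact quasiRegular_zero_one f

lemma inner_rep_left (p : E d × H) (f g : L2 d) :
    inner ℂ (rep p f) g = inner ℂ f (rep (ginv p) g) := by
  rw [← inner_quasiRegular (ginv p).1 ((ginv p).2 : GL (Fin d) ℝ) (rep p f) g]
  exact congrArg (fun u => inner ℂ u (rep (ginv p) g)) (rep_ginv_rep p f)

lemma continuous_gmul_uncurry :
    Continuous fun r : (E d × H) × (E d × H) => gmul r.1 r.2 := by
  unfold gmul; fun_prop

lemma continuous_ginv : Continuous (ginv : E d × H → E d × H) := by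
  unfold ginv; fun_prop

variable [LocallyCompactSpace H]

lemma lintegral_haarSemidirect {F : E d × H → ℝ≥0∞} (hF : Measurable F) :
    ∫⁻ p, F p ∂(haarSemidirect H) =
      ∫⁻ h : H, ENNReal.ofReal (absDet (h : GL (Fin d) ℝ))⁻¹ * ∫⁻ x, F (x, h) ∂volume
        ∂Measure.haar := by
  have hm : Measurable fun h : H => ENNReal.ofReal (absDet (h : GL (Fin d) ℝ))⁻¹ := by
    fun_prop
  rw [haarSemidirect, lintegral_prod_symm _ hF.aemeasurable,
    lintegral_withDensity_eq_lintegral_mul _ hm hF.lintegral_prod_left']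
  rfl

instance sFinite_haarSemidirect : SFinite (haarSemidirect H) := by
  unfold haarSemidirect; infer_instance

/-- The substitution in the translation variable costs `|det p.2|⁻¹`. This is exactly what turns the
density `|det h|⁻¹` into `|det (p.2 h)|⁻¹`, after which left invariance on `H` applies. -/
lemma lintegral_gmul_left (p : E d × H) {F : E d × H → ℝ≥0∞} (hF : Measurable F) :
    ∫⁻ q, F (gmul p q) ∂(haarSemidirect H) = ∫⁻ q, F q ∂(haarSemidirect H) := by
  have hg : Continuous fun q : E d × H => gmul p q := by unfold gmul; fun_prop
  rw [lintegral_haarSemidirect (F := fun q => F (gmul p q)) (hF.comp hg.measurable),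
    lintegral_haarSemidirect hF,
    ← lintegral_mul_left_eq_self
      (fun h : H => ENNReal.ofReal (absDet (h : GL (Fin d) ℝ))⁻¹ * ∫⁻ x, F (x, h)) p.2]
  refine lintegral_congr fun h => ?_
  have h1 : ∫⁻ x, F (gmul p (x, h)) =
      ENNReal.ofReal (absDet (p.2 : GL (Fin d) ℝ))⁻¹ * ∫⁻ x, F (x, p.2 * h) := by
    rw [← lintegral_add_left_eq_self (fun x => F (x, p.2 * h)) p.1,
      ← lintegral_comp_act (p.2 : GL (Fin d) ℝ) (fun x => F (p.1 + x, p.2 * h))]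
    rfl
  rw [h1, ← mul_assoc, ← ENNReal.ofReal_mul (inv_pos.2 (absDet_pos _)).le, Subgroup.coe_mul,
    absDet_mul, mul_inv, mul_comm (absDet (h : GL (Fin d) ℝ))⁻¹]

end Semidirect

/-! ### Wavelet transforms and weighted `L¹` norms -/

section Weighted

variable {d : ℕ} {H : Subgroup (GL (Fin d) ℝ)}

lemma waveletTransform_apply (χ f : L2 d) (p : E d × H) :
    waveletTransform H χ f p = inner ℂ (rep p χ) f := rfl

lemma measurable_uncurry_quasiRegularFun {F : E d → ℂ} (hF : Measurable F) :
    Measurable fun q : (E d × H) × E d => quasiRegularFun q.1.1 (q.1.2 : GL (Fin d) ℝ) F q.2 := by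
  unfold quasiRegularFun
  refine Measurable.mul ?_ (hF.comp ?_)
  · have h1 : Measurable fun q : (E d × H) × E d => absDet (q.1.2 : GL (Fin d) ℝ) :=
      Continuous.measurable (by fun_prop)
    exact Complex.measurable_ofReal.comp (h1.pow_const _)
  · exact Continuous.measurable (by fun_prop)

lemma waveletTransform_eq_integral (χ f : L2 d) {F G : E d → ℂ} (hF : χ =ᵐ[volume] F)
    (hG : f =ᵐ[volume] G) (p : E d × H) :
    waveletTransform H χ f p =
      ∫ y, inner ℂ (quasiRegularFun p.1 (p.2 : GL (Fin d) ℝ) F y) (G y) := by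
  rw [waveletTransform_apply, L2.inner_def]
  refine integral_congr_ae ?_
  filter_upwards [coeFn_quasiRegular p.1 (p.2 : GL (Fin d) ℝ) χ,
    quasiRegularFun_congr p.1 (p.2 : GL (Fin d) ℝ) hF, hG] with y h1 h2 h3
  rw [h1, h2, h3]

lemma measurable_waveletTransform (χ f : L2 d) : Measurable (waveletTransform H χ f) := by
  have h1 : waveletTransform H χ f = fun p =>
      ∫ y, inner ℂ (quasiRegularFun p.1 (p.2 : GL (Fin d) ℝ) χ y) (f y) :=
    funext fun p => waveletTransform_eq_integral χ f (ae_eq_refl _) (ae_eq_refl _) p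
  rw [h1]
  refine StronglyMeasurable.measurable (StronglyMeasurable.integral_prod_right
    (f := fun (p : E d × H) y => inner ℂ (quasiRegularFun p.1 (p.2 : GL (Fin d) ℝ) χ y) (f y)) ?_)
  refine Measurable.stronglyMeasurable (Measurable.inner ?_ ?_)
  · exact measurable_uncurry_quasiRegularFun (Lp.stronglyMeasurable χ).measurable
  · exact (Lp.stronglyMeasurable f).measurable.comp measurable_snd

lemma enorm_waveletTransform_le (χ f : L2 d) (p : E d × H) :
    ‖waveletTransform H χ f p‖ₑ ≤ ENNReal.ofReal (‖χ‖ * ‖f‖) := by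
  rw [← ofReal_norm]
  refine ENNReal.ofReal_le_ofReal ((norm_inner_le_norm _ _).trans_eq ?_)
  congr 1
  exact (quasiRegularₗᵢ p.1 (p.2 : GL (Fin d) ℝ)).norm_map χ

lemma waveletTransform_rep_right (χ f : L2 d) (p q : E d × H) :
    waveletTransform H χ (rep p f) (gmul p q) = waveletTransform H χ f q := by
  rw [waveletTransform_apply, waveletTransform_apply, ← rep_rep]
  exact inner_quasiRegular _ _ _ _

/-- Both sides are the modulus of `⟨σ(q)χ, σ(p)χ⟩`, up to conjugation. The symmetry brings the
kernels of the orthogonality relations into convolution form. -/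
lemma enorm_waveletTransform_ginv_gmul (χ : L2 d) (p q : E d × H) :
    ‖waveletTransform H χ χ (gmul (ginv p) q)‖ₑ = ‖waveletTransform H χ χ (gmul (ginv q) p)‖ₑ := by
  have h1 : ∀ p q : E d × H, waveletTransform H χ χ (gmul (ginv p) q) =
      inner ℂ (rep q χ) (rep p χ) := by
    intro p q
    rw [← waveletTransform_rep_right χ χ p, gmul_ginv_cancel_left]
    rfl
  rw [h1, h1, ← inner_conj_symm]
  exact RCLike.enorm_conj _

variable [LocallyCompactSpace H]

/-- The norm of `L¹_w(G)` as a Lebesgue integral with values in `[0, ∞]`. -/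
def weightedLIntegral (H : Subgroup (GL (Fin d) ℝ)) [LocallyCompactSpace H] (w : H → ℝ)
    (F : E d × H → ℂ) : ℝ≥0∞ :=
  ∫⁻ p, ENNReal.ofReal (w p.2) * ‖F p‖ₑ ∂(haarSemidirect H)

lemma lintegral_enorm_weight_mul {w : H → ℝ} (hw : ∀ h, 0 ≤ w h) (F : E d × H → ℂ) :
    ∫⁻ p, ‖(w p.2 : ℂ) * F p‖ₑ ∂(haarSemidirect H) = weightedLIntegral H w F := by
  refine lintegral_congr fun p => ?_
  rw [enorm_mul, ← ofReal_norm (w p.2 : ℂ), Complex.norm_real, Real.norm_of_nonneg (hw _)]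

lemma memWeightedL1_iff {w : H → ℝ} (hw : ∀ h, 0 ≤ w h) (hwm : Measurable w)
    {F : E d × H → ℂ} (hF : Measurable F) :
    MemWeightedL1 H w F ↔ weightedLIntegral H w F < ⊤ := by
  have hm : Measurable fun p : E d × H => (w p.2 : ℂ) * F p :=
    (Complex.measurable_ofReal.comp (hwm.comp measurable_snd)).mul hF
  rw [MemWeightedL1, Integrable, hasFiniteIntegral_iff_enorm, lintegral_enorm_weight_mul hw]
  exact and_iff_right hm.aestronglyMeasurable

lemma ofReal_weightedL1Norm {w : H → ℝ} (hw : ∀ h, 0 ≤ w h) {F : E d × H → ℂ}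
    (hF : MemWeightedL1 H w F) :
    ENNReal.ofReal (weightedL1Norm H w F) = weightedLIntegral H w F := by
  rw [weightedL1Norm, ofReal_integral_norm_eq_lintegral_enorm hF, lintegral_enorm_weight_mul hw]

/-- The weighted convolution estimate `L¹_v * L¹_u ⊆ L¹_v`. -/
lemma lintegral_convolution_le {v u : H → ℝ} (hv : ∀ h, 0 ≤ v h) (hvm : Measurable v)
    (hum : Measurable u) (hvu : ∀ a b, v (a * b) ≤ v a * u b) {A B : E d × H → ℝ≥0∞}
    (hA : Measurable A) (hB : Measurable B) :
    ∫⁻ z, ENNReal.ofReal (v z.2) * ∫⁻ y, A y * B (gmul (ginv y) z) ∂(haarSemidirect H)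
        ∂(haarSemidirect H) ≤
      (∫⁻ y, ENNReal.ofReal (v y.2) * A y ∂(haarSemidirect H)) *
        ∫⁻ z, ENNReal.ofReal (u z.2) * B z ∂(haarSemidirect H) := by
  have hgm : Measurable fun r : (E d × H) × (E d × H) => gmul (ginv r.2) r.1 :=
    (continuous_gmul_uncurry.comp
      ((continuous_ginv.comp continuous_snd).prodMk continuous_fst)).measurable
  have hvm' : Measurable fun p : E d × H => ENNReal.ofReal (v p.2) :=
    (hvm.comp measurable_snd).ennreal_ofReal
  have hum' : Measurable fun p : E d × H => ENNReal.ofReal (u p.2) :=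
    (hum.comp measurable_snd).ennreal_ofReal
  have hgm1 : ∀ y : E d × H, Measurable fun z : E d × H => gmul (ginv y) z := fun y =>
    Continuous.measurable (by unfold gmul; fun_prop)
  have hgm2 : ∀ z : E d × H, Measurable fun y : E d × H => gmul (ginv y) z := fun z =>
    Continuous.measurable (by unfold gmul ginv; fun_prop)
  have hB1 : ∀ y : E d × H, Measurable fun z => B (gmul (ginv y) z) := fun y => hB.comp (hgm1 y)
  have hB2 : ∀ z : E d × H, Measurable fun y => B (gmul (ginv y) z) := fun z => hB.comp (hgm2 z)
  have h1 : ∀ z, ENNReal.ofReal (v z.2) * ∫⁻ y, A y * B (gmul (ginv y) z) ∂(haarSemidirect H) =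
      ∫⁻ y, ENNReal.ofReal (v z.2) * (A y * B (gmul (ginv y) z)) ∂(haarSemidirect H) := fun z =>
    (lintegral_const_mul (f := fun y => A y * B (gmul (ginv y) z)) _ (hA.mul (hB2 z))).symm
  have h2 : ∀ y, ∫⁻ z, ENNReal.ofReal (v z.2) * (A y * B (gmul (ginv y) z)) ∂(haarSemidirect H) ≤
      (ENNReal.ofReal (v y.2) * A y) *
        ∫⁻ z, ENNReal.ofReal (u z.2) * B z ∂(haarSemidirect H) := by
    intro y
    -- Replacing `z` by `y z` undoes the twist in `B` and leaves the weight `v (y z)`, which splits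
    -- by the hypothesis `hvu`.
    rw [← lintegral_gmul_left y
        (F := fun z => ENNReal.ofReal (v z.2) * (A y * B (gmul (ginv y) z)))
        (hvm'.mul ((hB1 y).const_mul (A y))),
      ← lintegral_const_mul (f := fun z => ENNReal.ofReal (u z.2) * B z) _ (hum'.mul hB)]
    refine lintegral_mono fun z => ?_
    simp only [ginv_gmul_cancel_left]
    have h3 : ENNReal.ofReal (v (gmul y z).2) ≤
        ENNReal.ofReal (v y.2) * ENNReal.ofReal (u z.2) := by
      rw [← ENNReal.ofReal_mul (hv _)]
      exact ENNReal.ofReal_le_ofReal (hvu _ _)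
    calc ENNReal.ofReal (v (gmul y z).2) * (A y * B z)
        ≤ (ENNReal.ofReal (v y.2) * ENNReal.ofReal (u z.2)) * (A y * B z) := by gcongr
      _ = _ := by ring
  have hm : AEMeasurable (Function.uncurry fun z y : E d × H =>
      ENNReal.ofReal (v z.2) * (A y * B (gmul (ginv y) z)))
      ((haarSemidirect H).prod (haarSemidirect H)) :=
    ((hvm'.comp measurable_fst).mul ((hA.comp measurable_snd).mul (hB.comp hgm))).aemeasurable
  rw [lintegral_congr h1, lintegral_lintegral_swap hm,
    ← lintegral_mul_const (f := fun y => ENNReal.ofReal (v y.2) * A y) _ (hvm'.mul hA)]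
  exact lintegral_mono h2

end Weighted

/-! ### Continuity of the modular function -/

section Modular

open scoped Pointwise in
/-- The modular function of a locally compact group is continuous. -/
lemma continuous_modularCharacterFun {G : Type*} [Group G] [TopologicalSpace G]
    [IsTopologicalGroup G] [LocallyCompactSpace G] :
    Continuous (Measure.modularCharacterFun : G → NNReal) := by
  borelize G
  let μ : Measure G := Measure.haar
  obtain ⟨f, hfc, hf0, hf1⟩ := exists_continuous_nonneg_pos (1 : G)
  have hpos : 0 < ∫ x, f x ∂μ := f.continuous.integral_pos_of_hasCompactSupport_nonneg_nonzero
    hfc hf0 hf1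
  -- The modular function is the factor by which right translation changes the integral of one fixed
  -- bump, so its continuity is that of a parametric integral with locally uniform compact support.
  have h1 : ∀ g : G, (Measure.modularCharacterFun g : ℝ) = (∫ x, f (x * g) ∂μ) / ∫ x, f x ∂μ := by
    intro g
    rw [Measure.modularCharacterFun_eq_haarScalarFactor μ g,
      Measure.haarScalarFactor_eq_integral_div _ _ f.continuous hfc hpos.ne',
      integral_map (measurable_mul_const g).aemeasurable f.continuous.aestronglyMeasurable]
  have h2 : Continuous fun g : G => (Measure.modularCharacterFun g : ℝ) := by
    simp_rw [h1]
    refine Continuous.div_const (continuous_iff_continuousAt.2 fun g => ?_) _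
    obtain ⟨S, hS, hSg⟩ := exists_compact_mem_nhds g
    refine ContinuousOn.continuousAt (s := S) ?_ hSg
    refine continuousOn_integral_of_compact_support (k := tsupport f * S⁻¹)
      (hfc.isCompact.mul hS.inv) (by fun_prop) ?_
    intro p x hp hx
    by_contra h0
    refine hx ⟨x * p, subset_tsupport _ h0, p⁻¹, Set.inv_mem_inv.2 hp, by simp⟩
  exact NNReal.isEmbedding_coe.continuous_iff.2 h2

end Modular

/-! ### The control weight is measurable, locally bounded, submultiplicative and at least one -/

section ControlWeight

variable {d : ℕ} {H : Subgroup (GL (Fin d) ℝ)} {v v₀ : H → ℝ}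

lemma max_apply_inv_mul_le {G : Type*} [Group G] {u : G → ℝ} (hu : ∀ g, 0 ≤ u g)
    (hmul : ∀ g k, u (g * k) ≤ u g * u k) (g k : G) :
    max (u (g * k)) (u (g * k)⁻¹) ≤ max (u g) (u g⁻¹) * max (u k) (u k⁻¹) := by
  have h0 : ∀ g, 0 ≤ max (u g) (u g⁻¹) := fun g => (hu g).trans (le_max_left _ _)
  refine max_le ((hmul _ _).trans ?_) ?_
  · exact mul_le_mul (le_max_left _ _) (le_max_left _ _) (hu _) (h0 _)
  · rw [mul_inv_rev, mul_comm (max (u g) _)]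
    exact (hmul _ _).trans (mul_le_mul (le_max_right _ _) (le_max_right _ _) (hu _) (h0 _))

/-- From `1 ≤ u 1 ≤ u g * u g⁻¹`, the two values cannot both be below one. -/
lemma one_le_max_apply_inv {G : Type*} [Group G] {u : G → ℝ} (hu : ∀ g, 0 < u g)
    (hmul : ∀ g k, u (g * k) ≤ u g * u k) (g : G) : 1 ≤ max (u g) (u g⁻¹) := by
  have h1 : 1 ≤ u 1 := by
    have := hmul 1 1
    rw [mul_one] at this
    exact (le_mul_iff_one_le_left (hu 1)).1 this
  have h2 : 1 ≤ u g * u g⁻¹ := h1.trans (by simpa using hmul g g⁻¹)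
  by_contra! h
  obtain ⟨ha, hb⟩ := max_lt_iff.1 h
  exact h2.not_gt (mul_lt_one_of_nonneg_of_lt_one_left (hu g).le ha hb.le)

lemma IsModerate.one_le_one (hv : IsModerate H v v₀) : 1 ≤ v₀ 1 := by
  have := hv.submultiplicative 1 1
  rw [mul_one] at this
  exact (le_mul_iff_one_le_left (hv.pos 1)).1 this

lemma one_le_max_absDet (h : H) :
    1 ≤ max (absDet (h : GL (Fin d) ℝ)) (absDet ((h⁻¹ : H) : GL (Fin d) ℝ)) :=
  one_le_max_apply_inv (u := fun h : H => absDet (h : GL (Fin d) ℝ)) (fun _ => absDet_pos _)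
    (fun _ _ => (absDet_mul _ _).le) h

variable [LocallyCompactSpace H]

lemma continuous_modularFun : Continuous (modularFun H) :=
  NNReal.continuous_coe.comp continuous_modularCharacterFun

lemma modularFun_pos (h : H) : 0 < modularFun H h := Measure.modularCharacterFun_pos h

lemma modularFun_mul (h k : H) : modularFun H (h * k) = modularFun H h * modularFun H k := by
  simp [modularFun, Measure.modularCharacterFun_map_mul]

lemma one_le_max_modularFun (h : H) : 1 ≤ max (modularFun H h) (modularFun H h⁻¹) :=
  one_le_max_apply_inv modularFun_pos (fun _ _ => (modularFun_mul _ _).le) h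

lemma IsModerate.max_le_controlWeight (hv : IsModerate H v v₀) (h : H) :
    v₀ 1 * max (v₀ h) (v₀ h⁻¹) ≤ controlWeight H v₀ h := by
  have h0 : 0 ≤ v₀ 1 * max (v₀ h) (v₀ h⁻¹) :=
    mul_nonneg (hv.pos _).le ((hv.pos h).le.trans (le_max_left _ _))
  have h1 := le_mul_of_one_le_right h0 (one_le_max_absDet h)
  exact h1.trans (le_mul_of_one_le_right (h0.trans h1) (one_le_max_modularFun h))

lemma IsModerate.one_le_controlWeight (hv : IsModerate H v v₀) (h : H) :
    1 ≤ controlWeight H v₀ h :=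
  (one_le_mul_of_one_le_of_one_le hv.one_le_one
    (one_le_max_apply_inv hv.pos hv.submultiplicative h)).trans (hv.max_le_controlWeight h)

lemma IsModerate.mul_le_controlWeight (hv : IsModerate H v v₀) (h : H) :
    v₀ 1 * v₀ h ≤ controlWeight H v₀ h :=
  (mul_le_mul_of_nonneg_left (le_max_left _ _) (hv.pos 1).le).trans (hv.max_le_controlWeight h)

lemma IsModerate.controlWeight_nonneg (hv : IsModerate H v v₀) (h : H) :
    0 ≤ controlWeight H v₀ h := zero_le_one.trans (hv.one_le_controlWeight h)

/-- Each of the three symmetrized factors is submultiplicative; the constant `v₀ 1` occurs once on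
the left and twice on the right, which is harmless because `1 ≤ v₀ 1`. -/
lemma IsModerate.controlWeight_mul_le (hv : IsModerate H v v₀) (h k : H) :
    controlWeight H v₀ (h * k) ≤ controlWeight H v₀ h * controlWeight H v₀ k := by
  have e1 := max_apply_inv_mul_le (fun h => (hv.pos h).le) hv.submultiplicative h k
  have e2 := max_apply_inv_mul_le (u := fun h : H => absDet (h : GL (Fin d) ℝ))
    (fun _ => (absDet_pos _).le) (fun _ _ => (absDet_mul _ _).le) h k
  have e3 := max_apply_inv_mul_le (fun h => (modularFun_pos h).le)
    (fun _ _ => (modularFun_mul (H := H) _ _).le) h k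
  have p1 : ∀ h, 0 ≤ max (v₀ h) (v₀ h⁻¹) := fun h => (hv.pos h).le.trans (le_max_left _ _)
  have p2 : ∀ h : H, 0 ≤ max (absDet (h : GL (Fin d) ℝ)) (absDet ((h⁻¹ : H) : GL (Fin d) ℝ)) :=
    fun h => zero_le_one.trans (one_le_max_absDet h)
  have p3 : ∀ h : H, 0 ≤ max (modularFun H h) (modularFun H h⁻¹) :=
    fun h => zero_le_one.trans (one_le_max_modularFun h)
  have p4 := hv.one_le_one
  unfold controlWeight
  calc _ ≤ v₀ 1 * v₀ 1 * (max (v₀ h) (v₀ h⁻¹) * max (v₀ k) (v₀ k⁻¹)) *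
        (max (absDet (h : GL (Fin d) ℝ)) (absDet ((h⁻¹ : H) : GL (Fin d) ℝ)) *
          max (absDet (k : GL (Fin d) ℝ)) (absDet ((k⁻¹ : H) : GL (Fin d) ℝ))) *
        (max (modularFun H h) (modularFun H h⁻¹) * max (modularFun H k) (modularFun H k⁻¹)) := by
        have q1 := p1 (h * k)
        have q2 := p2 (h * k)
        have q3 := p3 (h * k)
        have := mul_nonneg (p1 h) (p1 k)
        have := mul_nonneg (p2 h) (p2 k)
        have := mul_nonneg (p3 h) (p3 k)
        refine mul_le_mul (mul_le_mul (mul_le_mul ?_ e1 q1 (by positivity)) e2 q2 (by positivity))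
          e3 q3 (by positivity)
        exact le_mul_of_one_le_right (by positivity) p4
    _ = _ := by ring

lemma IsModerate.measurable_controlWeight (hv : IsModerate H v v₀) :
    Measurable (controlWeight H v₀) := by
  unfold controlWeight
  have h1 := hv.measurable
  have h2 : Measurable (modularFun H) := continuous_modularFun.measurable
  have h3 : Measurable fun h : H => absDet (h : GL (Fin d) ℝ) :=
    Continuous.measurable (by fun_prop)
  have h4 : Measurable fun h : H => h⁻¹ := measurable_inv
  exact ((measurable_const.mul (h1.max (h1.comp h4))).mul (h3.max (h3.comp h4))).mul
    (h2.max (h2.comp h4))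

lemma IsModerate.controlWeight_bounded (hv : IsModerate H v v₀) {K : Set H} (hK : IsCompact K) :
    ∃ C, ∀ h ∈ K, controlWeight H v₀ h ≤ C := by
  obtain ⟨C1, h1⟩ := hv.bounded_on_compact K hK
  obtain ⟨C2, h2⟩ := hv.bounded_on_compact K⁻¹ hK.inv
  have hc : Continuous fun h : H =>
      max (absDet (h : GL (Fin d) ℝ)) (absDet ((h⁻¹ : H) : GL (Fin d) ℝ)) *
        max (modularFun H h) (modularFun H h⁻¹) := by
    have := continuous_modularFun (H := H)
    fun_prop
  obtain ⟨C3, h3⟩ := (hK.image hc).bddAbove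
  refine ⟨v₀ 1 * max C1 C2 * C3, fun h hh => ?_⟩
  rw [controlWeight, mul_assoc]
  have e1 : max (v₀ h) (v₀ h⁻¹) ≤ max C1 C2 :=
    max_le_max (h1 h hh) (h2 _ (Set.inv_mem_inv.2 hh))
  have e0 : 0 ≤ max (v₀ h) (v₀ h⁻¹) := (hv.pos h).le.trans (le_max_left _ _)
  refine mul_le_mul (mul_le_mul_of_nonneg_left e1 (hv.pos 1).le)
    (h3 (Set.mem_image_of_mem _ hh)) ?_ (mul_nonneg (hv.pos 1).le (e0.trans e1))
  exact mul_nonneg (zero_le_one.trans (one_le_max_absDet h))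
    (zero_le_one.trans (one_le_max_modularFun h))

/-- Orbits of analyzing vectors stay in `H¹_w`. -/
lemma IsModerate.rep_mem_H1w (hv : IsModerate H v v₀) {χ : L2 d}
    (hχ : χ ∈ analyzingVectors H (controlWeight H v₀)) (p : E d × H) :
    rep p χ ∈ H1w H (controlWeight H v₀) χ := by
  have hw := hv.controlWeight_nonneg
  have hwm := hv.measurable_controlWeight
  have hwm' : Measurable fun p : E d × H => ENNReal.ofReal (controlWeight H v₀ p.2) :=
    (hwm.comp measurable_snd).ennreal_ofReal
  have h1 := (memWeightedL1_iff hw hwm (measurable_waveletTransform χ χ)).1 hχ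
  refine (memWeightedL1_iff hw hwm (measurable_waveletTransform χ (rep p χ))).2 ?_
  unfold weightedLIntegral
  rw [← lintegral_gmul_left p (F := fun q => ENNReal.ofReal (controlWeight H v₀ q.2) *
    ‖waveletTransform H χ (rep p χ) q‖ₑ)
    (hwm'.mul (measurable_waveletTransform χ (rep p χ)).enorm)]
  simp only [waveletTransform_rep_right]
  refine lt_of_le_of_lt ?_ (ENNReal.mul_lt_top
    (ENNReal.ofReal_lt_top (r := controlWeight H v₀ p.2)) h1)
  rw [weightedLIntegral, ← lintegral_const_mul (f := fun q =>
    ENNReal.ofReal (controlWeight H v₀ q.2) * ‖waveletTransform H χ χ q‖ₑ) _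
    (hwm'.mul (measurable_waveletTransform χ χ).enorm)]
  refine lintegral_mono fun q => ?_
  rw [← mul_assoc, ← ENNReal.ofReal_mul (hw _)]
  gcongr
  exact hv.controlWeight_mul_le _ _

end ControlWeight

/-! ### The representation on the Fourier side -/

section Fourier

variable {d : ℕ}

/-- A Schwartz function as an element of `L²`. -/
def toL2 (f : 𝓢(E d, ℂ)) : L2 d := f.toLp 2

lemma coeFn_toL2 (f : 𝓢(E d, ℂ)) : toL2 f =ᵐ[volume] f := f.coeFn_toLp 2

lemma fourier_toL2 (f : 𝓢(E d, ℂ)) : 𝓕 (toL2 f) = toL2 (𝓕 f) := f.toLp_fourier_eq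

lemma memLp_modulate (x : E d) {f : E d → ℂ} (hf : MemLp f 2 volume) :
    MemLp (fun ξ => Real.fourierChar (-inner ℝ x ξ) • f ξ) 2 volume := by
  refine hf.of_le ?_ (Filter.Eventually.of_forall fun ξ => by rw [Circle.norm_smul])
  have h1 : Continuous fun ξ : E d => (Real.fourierChar (-inner ℝ x ξ) : ℂ) :=
    continuous_subtype_val.comp (Real.continuous_fourierChar.comp (by fun_prop))
  exact h1.aestronglyMeasurable.mul hf.aestronglyMeasurable

/-- Multiplication by the character `ξ ↦ e^{-2πi⟨x, ξ⟩}` on `L²`. -/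
def modulate (x : E d) : L2 d →ₗᵢ[ℂ] L2 d where
  toFun f := (memLp_modulate x (Lp.memLp f)).toLp _
  map_add' f g := by
    refine Lp.ext ((MemLp.coeFn_toLp _).trans ?_)
    filter_upwards [Lp.coeFn_add f g, (memLp_modulate x (Lp.memLp f)).coeFn_toLp,
      (memLp_modulate x (Lp.memLp g)).coeFn_toLp,
      Lp.coeFn_add ((memLp_modulate x (Lp.memLp f)).toLp _)
        ((memLp_modulate x (Lp.memLp g)).toLp _)] with ξ h1 h2 h3 h4
    rw [h4, Pi.add_apply, h2, h3, h1, Pi.add_apply, smul_add]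
  map_smul' c f := by
    refine Lp.ext ((MemLp.coeFn_toLp _).trans ?_)
    filter_upwards [Lp.coeFn_smul c f, (memLp_modulate x (Lp.memLp f)).coeFn_toLp,
      Lp.coeFn_smul c ((memLp_modulate x (Lp.memLp f)).toLp _)] with ξ h1 h2 h4
    rw [RingHom.id_apply, h4, Pi.smul_apply, h2, h1, Pi.smul_apply, smul_comm]
  norm_map' f := by
    change ‖(memLp_modulate x (Lp.memLp f)).toLp _‖ = ‖f‖
    rw [Lp.norm_toLp, Lp.norm_def]
    congr 1
    exact eLpNorm_congr_norm_ae (Filter.Eventually.of_forall fun ξ => by rw [Circle.norm_smul])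

lemma coeFn_modulate (x : E d) (f : L2 d) :
    modulate x f =ᵐ[volume] fun ξ => Real.fourierChar (-inner ℝ x ξ) • f ξ :=
  (memLp_modulate x (Lp.memLp f)).coeFn_toLp

lemma absDet_transposeGL_inv_rpow (g : GL (Fin d) ℝ) :
    absDet (transposeGL g)⁻¹ ^ (-(1 / 2) : ℝ) = absDet g ^ (1 / 2 : ℝ) := by
  rw [absDet_inv, absDet_transposeGL, Real.inv_rpow (absDet_pos g).le,
    Real.rpow_neg (absDet_pos g).le, inv_inv]

/-- `y ↦ |det g|^{-1/2} f (g⁻¹ (y - x))` for a Schwartz function `f`. -/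
def quasiRegularSchwartz (x : E d) (g : GL (Fin d) ℝ) (f : 𝓢(E d, ℂ)) : 𝓢(E d, ℂ) :=
  ((absDet g ^ (-(1 / 2) : ℝ) : ℝ) : ℂ) • SchwartzMap.compSubConstCLM ℂ x
    (SchwartzMap.compCLMOfContinuousLinearEquiv ℂ
      (LinearEquiv.toContinuousLinearEquiv
        { Matrix.toEuclideanLin ((g⁻¹ : GL (Fin d) ℝ) : Matrix (Fin d) (Fin d) ℝ) with
          invFun := act g
          left_inv := act_act_inv g
          right_inv := act_inv_act g } : E d ≃L[ℝ] E d) f)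

lemma coe_quasiRegularSchwartz (x : E d) (g : GL (Fin d) ℝ) (f : 𝓢(E d, ℂ)) :
    ⇑(quasiRegularSchwartz x g f) = quasiRegularFun x g f := rfl

lemma quasiRegular_toL2 (x : E d) (g : GL (Fin d) ℝ) (f : 𝓢(E d, ℂ)) :
    quasiRegular x g (toL2 f) = toL2 (quasiRegularSchwartz x g f) :=
  quasiRegular_toLp x g (f.memLp 2)

lemma fourier_quasiRegularFun (x : E d) (g : GL (Fin d) ℝ) (f : E d → ℂ) (ξ : E d) :
    𝓕 (quasiRegularFun x g f) ξ =
      ((absDet g ^ (1 / 2 : ℝ) : ℝ) : ℂ) *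
        (Real.fourierChar (-inner ℝ x ξ) • 𝓕 f (act (transposeGL g) ξ)) := by
  have h1 : 𝓕 (quasiRegularFun x g f) ξ = ∫ y, (fun u => ((absDet g ^ (-(1 / 2) : ℝ) : ℝ) : ℂ) *
      ((Real.fourierChar (-inner ℝ x ξ) : ℂ) * (fun w => Real.fourierChar
        (-inner ℝ w (act (transposeGL g) ξ)) • f w) (act g⁻¹ u))) (y - x) := by
    rw [Real.fourier_eq]
    refine integral_congr_ae (Filter.Eventually.of_forall fun y => ?_)
    have h2 : -inner ℝ y ξ = -inner ℝ x ξ + -inner ℝ (act g⁻¹ (y - x)) (act (transposeGL g) ξ) := by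
      rw [← inner_act, act_act_inv, inner_sub_left]; ring
    simp only [quasiRegularFun, h2, AddChar.map_add_eq_mul, mul_smul, mul_smul_comm]
    simp only [Circle.smul_def, smul_eq_mul]
    ring
  rw [h1, integral_sub_right_eq_self (fun u => ((absDet g ^ (-(1 / 2) : ℝ) : ℝ) : ℂ) *
      ((Real.fourierChar (-inner ℝ x ξ) : ℂ) * (fun w => Real.fourierChar
        (-inner ℝ w (act (transposeGL g) ξ)) • f w) (act g⁻¹ u))) x, integral_const_mul,
    integral_const_mul, integral_comp_act g⁻¹ (fun w => Real.fourierChar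
        (-inner ℝ w (act (transposeGL g) ξ)) • f w), ← Real.fourier_eq, absDet_inv, inv_inv,
    Complex.real_smul, Circle.smul_def, smul_eq_mul]
  have h3 : absDet g ^ (1 / 2 : ℝ) = absDet g ^ (-(1 / 2) : ℝ) * absDet g := by
    rw [← Real.rpow_add_one (absDet_pos g).ne']
    norm_num
  rw [h3, Complex.ofReal_mul]
  ring

/-- Both sides are continuous in `f`, so it is enough to compare them on the dense subspace of
Schwartz functions, where the integral formula is available. -/
lemma fourier_quasiRegular_eq (x : E d) (g : GL (Fin d) ℝ) (f : L2 d) :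
    𝓕 (quasiRegular x g f) = modulate x (quasiRegular 0 (transposeGL g)⁻¹ (𝓕 f)) := by
  have hF : Continuous fun f : L2 d => (𝓕 f : L2 d) := continuous_fourier
  refine DenseRange.induction_on
    (p := fun f : L2 d => 𝓕 (quasiRegular x g f) =
      modulate x (quasiRegular 0 (transposeGL g)⁻¹ (𝓕 f)))
    (SchwartzMap.denseRange_toLpCLM (p := 2) (μ := (volume : Measure (E d))) (F := ℂ)
      ENNReal.ofNat_ne_top) f ?_ ?_
  · refine isClosed_eq ?_ ?_
    · exact hF.comp (quasiRegularₗᵢ x g).continuous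
    · exact (modulate x).continuous.comp
        ((quasiRegularₗᵢ 0 (transposeGL g)⁻¹).continuous.comp hF)
  · intro f
    change 𝓕 (quasiRegular x g (toL2 f)) =
      modulate x (quasiRegular 0 (transposeGL g)⁻¹ (𝓕 (toL2 f)))
    rw [quasiRegular_toL2, fourier_toL2, fourier_toL2,
      quasiRegular_toL2]
    refine Lp.ext ?_
    filter_upwards [coeFn_toL2 (𝓕 (quasiRegularSchwartz x g f)), coeFn_modulate x
      (toL2 (quasiRegularSchwartz 0 (transposeGL g)⁻¹ (𝓕 f))),
      coeFn_toL2 (quasiRegularSchwartz 0 (transposeGL g)⁻¹ (𝓕 f))] with ξ h2 h3 h1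
    rw [h2, h3]
    rw [h1, SchwartzMap.fourier_coe, coe_quasiRegularSchwartz, coe_quasiRegularSchwartz,
      fourier_quasiRegularFun, quasiRegularFun, inv_inv, sub_zero, absDet_transposeGL_inv_rpow,
      SchwartzMap.fourier_coe, mul_smul_comm]

/-- The Fourier transform intertwines the quasi-regular representation with the dual action. -/
lemma coeFn_fourier_quasiRegular (x : E d) (g : GL (Fin d) ℝ) (f : L2 d) :
    (𝓕 (quasiRegular x g f) : L2 d) =ᵐ[volume] fun ξ => ((absDet g ^ (1 / 2 : ℝ) : ℝ) : ℂ) *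
        (Real.fourierChar (-inner ℝ x ξ) • (𝓕 f : L2 d) (act (transposeGL g) ξ)) := by
  rw [fourier_quasiRegular_eq]
  filter_upwards [coeFn_modulate x (quasiRegular 0 (transposeGL g)⁻¹ (𝓕 f)),
    coeFn_quasiRegular 0 (transposeGL g)⁻¹ (𝓕 f)] with ξ h1 h2
  rw [h1, h2, quasiRegularFun, inv_inv, sub_zero, absDet_transposeGL_inv_rpow, mul_smul_comm]

end Fourier

/-! ### The wavelet transform as a function of the translation -/

section WaveletFourier

variable {d : ℕ} {H : Subgroup (GL (Fin d) ℝ)}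

/-- The Fourier transform of the wavelet transform in the translation variable. -/
def waveletSymbol (X F : E d → ℂ) (h : GL (Fin d) ℝ) (ξ : E d) : ℂ :=
  ((absDet h ^ (1 / 2 : ℝ) : ℝ) : ℂ) * inner ℂ (X (act (transposeGL h) ξ)) (F ξ)

lemma waveletTransform_eq_fourierInv (χ f : L2 d) {X F : E d → ℂ}
    (hX : (𝓕 χ : L2 d) =ᵐ[volume] X) (hF : (𝓕 f : L2 d) =ᵐ[volume] F) (x : E d) (h : H) :
    waveletTransform H χ f (x, h) = 𝓕⁻ (waveletSymbol X F (h : GL (Fin d) ℝ)) x := by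
  rw [waveletTransform_apply, ← Lp.inner_fourier_eq, L2.inner_def, Real.fourierInv_eq]
  refine integral_congr_ae ?_
  filter_upwards [coeFn_fourier_quasiRegular x (h : GL (Fin d) ℝ) χ,
    (quasiMeasurePreserving_act (transposeGL (h : GL (Fin d) ℝ))).ae_eq_comp hX, hF]
    with ξ h1 h2 h3
  rw [h1, h3]
  rw [Function.comp_apply, Function.comp_apply] at h2
  rw [h2, waveletSymbol, real_inner_comm, Circle.smul_def, Circle.smul_def]
  simp only [RCLike.inner_apply, map_mul, Complex.conj_ofReal, smul_eq_mul, AddChar.map_neg_eq_inv,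
    Circle.coe_inv_eq_conj, Complex.conj_conj]
  ring

/-- A product of two `L²` functions. For general `χ` and `f` integrability is what is used below;
that is why Parseval's formula takes its second pair of functions from the Schwartz space. -/
lemma integrable_waveletSymbol (χ f : L2 d) (h : GL (Fin d) ℝ) :
    Integrable (waveletSymbol (𝓕 χ : L2 d) (𝓕 f : L2 d) h) := by
  have h1 := memLp_quasiRegularFun 0 (transposeGL h)⁻¹ (Lp.memLp (𝓕 χ : L2 d))
  have h2 := L2.integrable_inner (𝕜 := ℂ) (h1.toLp _) (𝓕 f : L2 d)
  refine h2.congr ?_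
  filter_upwards [h1.coeFn_toLp] with ξ h3
  rw [h3, waveletSymbol, quasiRegularFun, inv_inv, sub_zero, absDet_transposeGL_inv_rpow]
  simp only [RCLike.inner_apply, map_mul, Complex.conj_ofReal]
  ring

/-- The wavelet transform of integrable functions is integrable in the translation variable. -/
lemma lintegral_enorm_waveletTransform_le (η g : 𝓢(E d, ℂ)) (h : H) :
    ∫⁻ x, ‖waveletTransform H (toL2 η) (toL2 g) (x, h)‖ₑ ≤
      ENNReal.ofReal (absDet (h : GL (Fin d) ℝ) ^ (1 / 2 : ℝ)) *
        ((∫⁻ y, ‖η y‖ₑ) * ∫⁻ y, ‖g y‖ₑ) := by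
  have hc := absDet_pos (h : GL (Fin d) ℝ)
  have hm : Measurable fun q : E d × E d =>
      ‖quasiRegularFun q.1 (h : GL (Fin d) ℝ) η q.2‖ₑ * ‖g q.2‖ₑ := by
    have e2 : Measurable fun q : E d × E d => quasiRegularFun q.1 (h : GL (Fin d) ℝ) η q.2 := by
      have e1 : Continuous fun q : E d × E d => act (h : GL (Fin d) ℝ)⁻¹ (q.2 - q.1) := by fun_prop
      exact (η.continuous.comp e1).measurable.const_mul _
    have e3 : Measurable fun q : E d × E d => g q.2 := g.continuous.measurable.comp measurable_snd
    exact e2.enorm.mul e3.enorm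
  calc ∫⁻ x, ‖waveletTransform H (toL2 η) (toL2 g) (x, h)‖ₑ
      ≤ ∫⁻ x, ∫⁻ y, ‖quasiRegularFun x (h : GL (Fin d) ℝ) η y‖ₑ * ‖g y‖ₑ := by
        refine lintegral_mono fun x => ?_
        rw [waveletTransform_eq_integral _ _ (coeFn_toL2 η) (coeFn_toL2 g)]
        refine (enorm_integral_le_lintegral_enorm _).trans (lintegral_mono fun y => ?_)
        rw [RCLike.inner_apply, enorm_mul, RCLike.enorm_conj, mul_comm]
    _ = ∫⁻ y, ∫⁻ x, ‖quasiRegularFun x (h : GL (Fin d) ℝ) η y‖ₑ * ‖g y‖ₑ :=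
        lintegral_lintegral_swap hm.aemeasurable
    _ = ∫⁻ y, (ENNReal.ofReal (absDet (h : GL (Fin d) ℝ) ^ (1 / 2 : ℝ)) * ∫⁻ y, ‖η y‖ₑ) *
          ‖g y‖ₑ := by
        refine lintegral_congr fun y => ?_
        rw [lintegral_mul_const']
        swap; · exact enorm_ne_top
        congr 1
        have h1 : ∀ x, ‖quasiRegularFun x (h : GL (Fin d) ℝ) η y‖ₑ =
            (fun u => ENNReal.ofReal (absDet (h : GL (Fin d) ℝ) ^ (-(1 / 2) : ℝ)) *
              ‖η (act (h : GL (Fin d) ℝ)⁻¹ u)‖ₑ) (y - x) := by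
          intro x
          rw [quasiRegularFun, enorm_mul, ← ofReal_norm, Complex.norm_real,
            Real.norm_of_nonneg (Real.rpow_nonneg hc.le _)]
        rw [lintegral_congr h1, lintegral_sub_left_eq_self (fun u => ENNReal.ofReal
            (absDet (h : GL (Fin d) ℝ) ^ (-(1 / 2) : ℝ)) * ‖η (act (h : GL (Fin d) ℝ)⁻¹ u)‖ₑ) y,
          lintegral_const_mul' _ _ ENNReal.ofReal_ne_top,
          lintegral_comp_act _ (fun u => ‖η u‖ₑ), ← mul_assoc,
          ← ENNReal.ofReal_mul (Real.rpow_nonneg hc.le _), absDet_inv, inv_inv,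
          ← Real.rpow_add_one hc.ne']
        norm_num
    _ = _ := by rw [lintegral_const_mul _ g.continuous.measurable.enorm, mul_assoc]

lemma coeFn_fourier_toL2 (η : 𝓢(E d, ℂ)) :
    (𝓕 (toL2 η) : L2 d) =ᵐ[volume] (𝓕 η : 𝓢(E d, ℂ)) := by
  rw [fourier_toL2]
  exact coeFn_toL2 _

lemma integrable_waveletTransform (η g : 𝓢(E d, ℂ)) (h : H) :
    Integrable fun x => waveletTransform H (toL2 η) (toL2 g) (x, h) := by
  refine ⟨((measurable_waveletTransform _ _).comp
    (measurable_id.prodMk measurable_const)).aestronglyMeasurable, ?_⟩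
  rw [hasFiniteIntegral_iff_enorm]
  have h1 : Integrable (η : E d → ℂ) := η.integrable
  have h2 : Integrable (g : E d → ℂ) := g.integrable
  refine (lintegral_enorm_waveletTransform_le η g h).trans_lt ?_
  exact ENNReal.mul_lt_top ENNReal.ofReal_lt_top
    (ENNReal.mul_lt_top h1.2 h2.2)

/-- Fourier inversion needs the symbol and its transform to be integrable. The latter is the
reflected wavelet transform, whose integrability was obtained directly on the space side. -/
lemma fourier_waveletTransform (η g : 𝓢(E d, ℂ)) (h : H) (ξ : E d) :
    𝓕 (fun x => waveletTransform H (toL2 η) (toL2 g) (x, h)) ξ =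
      waveletSymbol (𝓕 η : 𝓢(E d, ℂ)) (𝓕 g : 𝓢(E d, ℂ)) (h : GL (Fin d) ℝ) ξ := by
  set θ := waveletSymbol (𝓕 η : 𝓢(E d, ℂ)) (𝓕 g : 𝓢(E d, ℂ)) (h : GL (Fin d) ℝ) with hθ
  have h1 : (fun x => waveletTransform H (toL2 η) (toL2 g) (x, h)) = 𝓕⁻ θ :=
    funext fun x => waveletTransform_eq_fourierInv _ _ (coeFn_fourier_toL2 η)
      (coeFn_fourier_toL2 g) x h
  have hc : Continuous θ := by
    have e1 := (𝓕 η : 𝓢(E d, ℂ)).continuous.comp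
      (continuous_act (transposeGL (h : GL (Fin d) ℝ)))
    exact continuous_const.mul (e1.inner (𝓕 g : 𝓢(E d, ℂ)).continuous)
  have hi : Integrable θ := by
    refine (integrable_waveletSymbol (toL2 η) (toL2 g) (h : GL (Fin d) ℝ)).congr ?_
    filter_upwards [(quasiMeasurePreserving_act (transposeGL (h : GL (Fin d) ℝ))).ae_eq_comp
      (coeFn_fourier_toL2 η), coeFn_fourier_toL2 g] with ξ e1 e2
    rw [Function.comp_apply, Function.comp_apply] at e1
    rw [hθ, waveletSymbol, waveletSymbol, e1, e2]
  have hF : Integrable (𝓕 θ) := by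
    have e1 := (integrable_waveletTransform η g h).comp_neg
    have e2 : (fun x : E d => waveletTransform H (toL2 η) (toL2 g) (-x, h)) = 𝓕 θ := by
      funext x
      rw [congrFun h1 (-x), Real.fourierInv_eq_fourier_neg, neg_neg]
    rwa [e2] at e1
  rw [h1]
  exact hi.fourier_fourierInv_eq hF hc.continuousAt

/-- Parseval's formula in the translation variable. -/
lemma integral_inner_waveletTransform (χ f : L2 d) (η g : 𝓢(E d, ℂ)) (h : H) :
    ∫ x, inner ℂ (waveletTransform H χ f (x, h))
        (waveletTransform H (toL2 η) (toL2 g) (x, h)) =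
      absDet (h : GL (Fin d) ℝ) • ∫ ξ, inner ℂ ((𝓕 f : L2 d) ξ) ((𝓕 g : 𝓢(E d, ℂ)) ξ) *
        inner ℂ ((𝓕 η : 𝓢(E d, ℂ)) (act (transposeGL (h : GL (Fin d) ℝ)) ξ))
          ((𝓕 χ : L2 d) (act (transposeGL (h : GL (Fin d) ℝ)) ξ)) := by
  set G := waveletSymbol (𝓕 χ : L2 d) (𝓕 f : L2 d) (h : GL (Fin d) ℝ) with hG
  set W := fun x => waveletTransform H (toL2 η) (toL2 g) (x, h) with hW
  have h1 : ∀ x, waveletTransform H χ f (x, h) = 𝓕⁻ G x := fun x =>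
    waveletTransform_eq_fourierInv _ _ (ae_eq_refl _) (ae_eq_refl _) x h
  simp_rw [h1]
  -- The Fourier transform is moved across the pairing by Fubini, for which integrability of `G` and
  -- of `W` suffices. The form `-innerₗ` makes the transform of `G` the inverse one and that of `W`
  -- the direct one.
  have h2 : ∫ x, innerSL ℂ (𝓕⁻ G x) (W x) = ∫ ξ, innerSL ℂ (G ξ) (𝓕 W ξ) := by
    have e1 := VectorFourier.integral_sesq_fourierIntegral_eq_neg_flip (innerSL ℂ (E := ℂ))
      (μ := (volume : Measure (E d))) (ν := (volume : Measure (E d))) (L := -innerₗ (E d))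
      Real.continuous_fourierChar (by simp; fun_prop)
      (integrable_waveletSymbol χ f (h : GL (Fin d) ℝ)) (integrable_waveletTransform η g h)
    have e2 : -(-innerₗ (E d)).flip = innerₗ (E d) := by
      ext x y
      simp [real_inner_comm]
    rw [e2] at e1
    exact e1
  refine h2.trans ?_
  rw [← integral_smul]
  refine integral_congr_ae (Filter.Eventually.of_forall fun ξ => ?_)
  have h3 : 𝓕 W ξ = waveletSymbol (𝓕 η : 𝓢(E d, ℂ)) (𝓕 g : 𝓢(E d, ℂ)) (h : GL (Fin d) ℝ) ξ :=
    fourier_waveletTransform η g h ξ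
  have h4 : ((absDet (h : GL (Fin d) ℝ) : ℝ) : ℂ) =
      ((absDet (h : GL (Fin d) ℝ) ^ (1 / 2 : ℝ) : ℝ) : ℂ) *
        ((absDet (h : GL (Fin d) ℝ) ^ (1 / 2 : ℝ) : ℝ) : ℂ) := by
    rw [← Complex.ofReal_mul, ← Real.rpow_add (absDet_pos _)]
    norm_num
  beta_reduce
  rw [h3, hG, waveletSymbol, waveletSymbol, innerSL_apply_apply, Complex.real_smul, h4]
  simp only [RCLike.inner_apply, map_mul, Complex.conj_ofReal, Complex.conj_conj]
  ring

end WaveletFourier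

/-! ### Free open orbits, bandlimited functions and orthogonality relations -/

section Orbit

variable {d : ℕ} {H : Subgroup (GL (Fin d) ℝ)}

/-- The dual action `ξ ↦ hᵀ ξ`. -/
abbrev dualAct (h : H) (ξ : E d) : E d := act (transposeGL (h : GL (Fin d) ℝ)) ξ

lemma dualAct_mul (k h : H) (ξ : E d) : dualAct (k * h) ξ = dualAct h (dualAct k ξ) := by
  rw [dualAct, Subgroup.coe_mul, transposeGL_mul, act_mul]

/-- `O` is an open conull orbit of the dual action through `ξ₀` with trivial stabilizers, and `s`
is the continuous inverse of the orbit map `h ↦ hᵀ ξ₀`. -/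
structure IsFreeOpenOrbit (H : Subgroup (GL (Fin d) ℝ)) (ξ₀ : E d) (O : Set (E d))
    (s : E d → H) : Prop where
  isOpen : IsOpen O
  conull : volume Oᶜ = 0
  mem : ∀ h : H, dualAct h ξ₀ ∈ O
  dualAct_section : ∀ ξ ∈ O, dualAct (s ξ) ξ₀ = ξ
  section_dualAct : ∀ h : H, s (dualAct h ξ₀) = h
  continuousOn : ContinuousOn s O

variable {ξ₀ : E d} {O : Set (E d)} {s : E d → H}

lemma IsFreeOpenOrbit.base_mem (hO : IsFreeOpenOrbit H ξ₀ O s) : ξ₀ ∈ O := by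
  have h1 := hO.mem 1
  rwa [dualAct, Subgroup.coe_one, transposeGL_one, act_one] at h1

lemma IsFreeOpenOrbit.ae_mem (hO : IsFreeOpenOrbit H ξ₀ O s) : ∀ᵐ ξ, ξ ∈ O :=
  hO.conull

open scoped Pointwise in
/-- The dual action on the orbit is proper. -/
lemma IsFreeOpenOrbit.exists_isCompact (hO : IsFreeOpenOrbit H ξ₀ O s) {K₁ K₂ : Set (E d)}
    (h₁ : IsCompact K₁) (h₂ : IsCompact K₂) (hK₁ : K₁ ⊆ O) (hK₂ : K₂ ⊆ O) :
    ∃ Q : Set H, IsCompact Q ∧ ∀ h : H, ∀ ξ ∈ K₁, dualAct h ξ ∈ K₂ → h ∈ Q := by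
  -- `s ξ * h` carries the base point to `hᵀξ`, so `s ξ * h = s (hᵀξ)` and `h` is a quotient of
  -- values of `s` on the two compact sets.
  refine ⟨(s '' K₁)⁻¹ * s '' K₂, ((h₁.image_of_continuousOn (hO.continuousOn.mono hK₁)).inv).mul
    (h₂.image_of_continuousOn (hO.continuousOn.mono hK₂)), fun h ξ hξ hh => ?_⟩
  have e1 : dualAct (s ξ * h) ξ₀ = dualAct h ξ := by
    rw [dualAct_mul, hO.dualAct_section ξ (hK₁ hξ)]
  refine ⟨(s ξ)⁻¹, Set.inv_mem_inv.2 ⟨ξ, hξ, rfl⟩, s ξ * h, ⟨dualAct h ξ, hh, ?_⟩, by simp⟩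
  rw [← e1, hO.section_dualAct]

lemma continuous_dualAct_uncurry : Continuous fun p : H × E d => dualAct p.1 p.2 := by
  fun_prop

lemma continuous_dualAct_left (ξ : E d) : Continuous fun h : H => dualAct h ξ := by
  fun_prop

/-- Schwartz functions whose Fourier transform is compactly supported in `O`. -/
structure IsBandlimited (O : Set (E d)) (η : 𝓢(E d, ℂ)) : Prop where
  hasCompactSupport : HasCompactSupport (𝓕 η : 𝓢(E d, ℂ))
  tsupport_subset : tsupport (𝓕 η : 𝓢(E d, ℂ)) ⊆ O

lemma IsFreeOpenOrbit.exists_isCompact_bandlimited (hO : IsFreeOpenOrbit H ξ₀ O s)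
    {η g : 𝓢(E d, ℂ)} (hη : IsBandlimited O η) (hg : IsBandlimited O g) :
    ∃ Q : Set H, IsCompact Q ∧ ∀ h ∉ Q, ∀ ξ, (𝓕 g : 𝓢(E d, ℂ)) ξ = 0 ∨
      (𝓕 η : 𝓢(E d, ℂ)) (dualAct h ξ) = 0 := by
  obtain ⟨Q, hQ, hQ1⟩ := hO.exists_isCompact hg.hasCompactSupport.isCompact
    hη.hasCompactSupport.isCompact hg.tsupport_subset hη.tsupport_subset
  refine ⟨Q, hQ, fun h hh ξ => ?_⟩
  by_contra! hcon
  exact hh (hQ1 h ξ (subset_tsupport _ hcon.1) (subset_tsupport _ hcon.2))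

lemma waveletTransform_eq_zero {η g : 𝓢(E d, ℂ)} {h : H}
    (hh : ∀ ξ, (𝓕 g : 𝓢(E d, ℂ)) ξ = 0 ∨ (𝓕 η : 𝓢(E d, ℂ)) (dualAct h ξ) = 0) (x : E d) :
    waveletTransform H (toL2 η) (toL2 g) (x, h) = 0 := by
  rw [waveletTransform_eq_fourierInv _ _ (coeFn_fourier_toL2 η) (coeFn_fourier_toL2 g),
    Real.fourierInv_eq]
  have h1 : ∀ ξ, waveletSymbol (𝓕 η : 𝓢(E d, ℂ)) (𝓕 g : 𝓢(E d, ℂ)) (h : GL (Fin d) ℝ) ξ = 0 := by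
    intro ξ
    rcases hh ξ with h0 | h0 <;> simp [waveletSymbol, h0]
  simp [h1]

lemma measurable_comp_dualAct {F : Type*} [MeasurableSpace F] {f : E d → F} (hf : Measurable f) :
    Measurable fun q : H × E d => f (dualAct q.1 q.2) :=
  hf.comp continuous_dualAct_uncurry.measurable

lemma measurable_uncurry_comp_dualAct {f : E d → ℝ≥0∞} (hf : Measurable f) :
    Measurable (Function.uncurry fun (ξ : E d) (h : H) => f (dualAct h ξ)) := by
  have h1 : Continuous fun q : E d × H => dualAct q.2 q.1 := by fun_prop
  exact hf.comp h1.measurable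

variable [LocallyCompactSpace H]

/-- Moving the base point along the orbit is a left translation in `H`, so left invariance of Haar
measure makes the orbit integral constant. -/
lemma IsFreeOpenOrbit.lintegral_dualAct (hO : IsFreeOpenOrbit H ξ₀ O s) (F : E d → ℝ≥0∞)
    {ξ : E d} (hξ : ξ ∈ O) :
    ∫⁻ h : H, F (dualAct h ξ) ∂Measure.haar = ∫⁻ h : H, F (dualAct h ξ₀) ∂Measure.haar := by
  rw [← lintegral_mul_left_eq_self (fun h : H => F (dualAct h ξ₀)) (s ξ)]
  simp_rw [dualAct_mul, hO.dualAct_section ξ hξ]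

lemma IsFreeOpenOrbit.integral_dualAct (hO : IsFreeOpenOrbit H ξ₀ O s) (F : E d → ℂ)
    {ξ : E d} (hξ : ξ ∈ O) :
    ∫ h : H, F (dualAct h ξ) ∂Measure.haar = ∫ h : H, F (dualAct h ξ₀) ∂Measure.haar := by
  rw [← integral_mul_left_eq_self (fun h : H => F (dualAct h ξ₀)) (s ξ)]
  simp_rw [dualAct_mul, hO.dualAct_section ξ hξ]

/-- Wavelet transforms of bandlimited functions belong to all weighted `L¹` spaces. -/
lemma IsFreeOpenOrbit.weightedLIntegral_lt_top (hO : IsFreeOpenOrbit H ξ₀ O s)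
    {η g : 𝓢(E d, ℂ)} (hη : IsBandlimited O η) (hg : IsBandlimited O g) {w : H → ℝ}
    (hwm : Measurable w) (hw : ∀ K : Set H, IsCompact K → ∃ C, ∀ h ∈ K, w h ≤ C) :
    weightedLIntegral H w (waveletTransform H (toL2 η) (toL2 g)) < ⊤ := by
  obtain ⟨Q, hQ, hQ1⟩ := hO.exists_isCompact_bandlimited hη hg
  obtain ⟨C₁, hC₁⟩ := hw Q hQ
  have hc : Continuous fun h : H => (absDet (h : GL (Fin d) ℝ))⁻¹ *
      absDet (h : GL (Fin d) ℝ) ^ (1 / 2 : ℝ) :=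
    (Continuous.inv₀ (by fun_prop) fun h => (absDet_pos _).ne').mul
      (Continuous.rpow_const (by fun_prop) fun h => Or.inl (absDet_pos _).ne')
  obtain ⟨C₂, hC₂⟩ := (hQ.image hc).bddAbove
  have i1 : Integrable (η : E d → ℂ) := η.integrable
  have i2 : Integrable (g : E d → ℂ) := g.integrable
  set I : ℝ≥0∞ := (∫⁻ y, ‖η y‖ₑ) * ∫⁻ y, ‖g y‖ₑ with hI
  have hIt : I < ⊤ := ENNReal.mul_lt_top i1.2 i2.2
  have hm : Measurable fun p : E d × H => ENNReal.ofReal (w p.2) *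
      ‖waveletTransform H (toL2 η) (toL2 g) p‖ₑ :=
    (hwm.comp measurable_snd).ennreal_ofReal.mul (measurable_waveletTransform _ _).enorm
  rw [weightedLIntegral, lintegral_haarSemidirect hm]
  calc _ ≤ ∫⁻ h : H, Q.indicator (fun _ => ENNReal.ofReal C₂ * (ENNReal.ofReal C₁ * I)) h
        ∂Measure.haar := by
        refine lintegral_mono fun h => ?_
        by_cases hh : h ∈ Q
        · rw [Set.indicator_of_mem hh]
          dsimp only
          rw [lintegral_const_mul' _ _ ENNReal.ofReal_ne_top]
          calc _ ≤ ENNReal.ofReal (absDet (h : GL (Fin d) ℝ))⁻¹ * (ENNReal.ofReal C₁ *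
                (ENNReal.ofReal (absDet (h : GL (Fin d) ℝ) ^ (1 / 2 : ℝ)) * I)) := by
                gcongr
                · exact hC₁ h hh
                · exact lintegral_enorm_waveletTransform_le η g h
            _ = ENNReal.ofReal ((absDet (h : GL (Fin d) ℝ))⁻¹ *
                  absDet (h : GL (Fin d) ℝ) ^ (1 / 2 : ℝ)) * (ENNReal.ofReal C₁ * I) := by
                rw [ENNReal.ofReal_mul (inv_pos.2 (absDet_pos _)).le]; ring
            _ ≤ _ := by
                gcongr
                exact hC₂ (Set.mem_image_of_mem _ hh)
        · rw [Set.indicator_of_notMem hh]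
          simp [waveletTransform_eq_zero (hQ1 h hh)]
    _ = ENNReal.ofReal C₂ * (ENNReal.ofReal C₁ * I) * Measure.haar Q := by
        rw [lintegral_indicator hQ.measurableSet, setLIntegral_const]
    _ < ⊤ := by
        refine ENNReal.mul_lt_top (ENNReal.mul_lt_top ENNReal.ofReal_lt_top
          (ENNReal.mul_lt_top ENNReal.ofReal_lt_top hIt)) hQ.measure_lt_top

lemma lintegral_enorm_sq_lt_top (f : L2 d) : ∫⁻ x, ‖f x‖ₑ ^ 2 < ⊤ := by
  have h1 := (Lp.memLp f).integrable_norm_pow two_ne_zero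
  have h2 := h1.2
  rw [hasFiniteIntegral_iff_enorm] at h2
  simpa using h2

lemma enorm_mul_le_add_sq (a b : ℝ≥0∞) : a * b ≤ a ^ 2 + b ^ 2 := by
  rcases le_total a b with h | h
  · calc a * b ≤ b * b := by gcongr
      _ ≤ _ := by rw [sq b]; exact le_add_self
  · calc a * b ≤ a * a := by gcongr
      _ ≤ _ := by rw [sq a]; exact le_self_add

/-- The constant in the orthogonality relations. -/
def orbitPairing (H : Subgroup (GL (Fin d) ℝ)) [LocallyCompactSpace H] (ξ₀ : E d) (χ : L2 d)
    (η : 𝓢(E d, ℂ)) : ℂ :=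
  ∫ h : H, inner ℂ ((𝓕 η : 𝓢(E d, ℂ)) (dualAct h ξ₀)) ((𝓕 χ : L2 d) (dualAct h ξ₀)) ∂Measure.haar

/-- Justifies Fubini in the orthogonality relations. The bandlimited pair is bounded and confines
`h` to a compact set; what remains, a product of two `L²` functions, is bounded by the sum of their
squares. Hence no admissibility condition on `χ` is required. -/
lemma IsFreeOpenOrbit.integrable_orbit_integrand (hO : IsFreeOpenOrbit H ξ₀ O s) (χ f : L2 d)
    {η g : 𝓢(E d, ℂ)} (hη : IsBandlimited O η) (hg : IsBandlimited O g) :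
    Integrable (Function.uncurry fun (h : H) (ξ : E d) =>
      inner ℂ ((𝓕 f : L2 d) ξ) ((𝓕 g : 𝓢(E d, ℂ)) ξ) *
        inner ℂ ((𝓕 η : 𝓢(E d, ℂ)) (dualAct h ξ)) ((𝓕 χ : L2 d) (dualAct h ξ)))
      ((Measure.haar : Measure H).prod volume) := by
  obtain ⟨Q, hQ, hQ1⟩ := hO.exists_isCompact_bandlimited hη hg
  have hmχ : Measurable (𝓕 χ : L2 d) := (Lp.stronglyMeasurable _).measurable
  have hmf : Measurable (𝓕 f : L2 d) := (Lp.stronglyMeasurable _).measurable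
  have hmη : Measurable (𝓕 η : 𝓢(E d, ℂ)) := (𝓕 η : 𝓢(E d, ℂ)).continuous.measurable
  have hmg : Measurable (𝓕 g : 𝓢(E d, ℂ)) := (𝓕 g : 𝓢(E d, ℂ)).continuous.measurable
  have hm : Measurable (Function.uncurry fun (h : H) (ξ : E d) =>
      inner ℂ ((𝓕 f : L2 d) ξ) ((𝓕 g : 𝓢(E d, ℂ)) ξ) *
        inner ℂ ((𝓕 η : 𝓢(E d, ℂ)) (dualAct h ξ)) ((𝓕 χ : L2 d) (dualAct h ξ))) :=
    ((hmf.inner hmg).comp measurable_snd).mul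
      ((measurable_comp_dualAct hmη).inner (measurable_comp_dualAct hmχ))
  obtain ⟨M₁, hM₁⟩ : ∃ M : ℝ≥0∞, M < ⊤ ∧ ∀ ξ, ‖(𝓕 η : 𝓢(E d, ℂ)) ξ‖ₑ ≤ M :=
    ⟨_, ENNReal.ofReal_lt_top, fun ξ => by
      rw [← ofReal_norm]
      exact ENNReal.ofReal_le_ofReal (SchwartzMap.norm_le_seminorm ℝ (𝓕 η : 𝓢(E d, ℂ)) ξ)⟩
  obtain ⟨M₂, hM₂⟩ : ∃ M : ℝ≥0∞, M < ⊤ ∧ ∀ ξ, ‖(𝓕 g : 𝓢(E d, ℂ)) ξ‖ₑ ≤ M :=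
    ⟨_, ENNReal.ofReal_lt_top, fun ξ => by
      rw [← ofReal_norm]
      exact ENNReal.ofReal_le_ofReal (SchwartzMap.norm_le_seminorm ℝ (𝓕 g : 𝓢(E d, ℂ)) ξ)⟩
  have hc : Continuous fun h : H => (absDet (transposeGL (h : GL (Fin d) ℝ)))⁻¹ :=
    Continuous.inv₀ (by fun_prop) fun h => (absDet_pos _).ne'
  obtain ⟨C, hC⟩ := (hQ.image hc).bddAbove
  set N₁ := ∫⁻ ξ, ‖(𝓕 f : L2 d) ξ‖ₑ ^ 2 with hN₁
  set N₂ := ∫⁻ ξ, ‖(𝓕 χ : L2 d) ξ‖ₑ ^ 2 with hN₂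
  refine ⟨hm.aestronglyMeasurable, ?_⟩
  rw [hasFiniteIntegral_iff_enorm, lintegral_prod _ hm.enorm.aemeasurable]
  calc _ ≤ ∫⁻ h : H, Q.indicator (fun _ => M₁ * M₂ * (N₁ + ENNReal.ofReal C * N₂)) h
        ∂Measure.haar := by
        refine lintegral_mono fun h => ?_
        by_cases hh : h ∈ Q
        · rw [Set.indicator_of_mem hh]
          calc _ ≤ ∫⁻ ξ, M₁ * M₂ * (‖(𝓕 f : L2 d) ξ‖ₑ ^ 2 +
                ‖(𝓕 χ : L2 d) (dualAct h ξ)‖ₑ ^ 2) := by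
                refine lintegral_mono fun ξ => ?_
                simp only [Function.uncurry, RCLike.inner_apply, enorm_mul, RCLike.enorm_conj]
                calc _ ≤ M₂ * ‖(𝓕 f : L2 d) ξ‖ₑ * (‖(𝓕 χ : L2 d) (dualAct h ξ)‖ₑ * M₁) := by
                      gcongr
                      · exact hM₂.2 _
                      · exact hM₁.2 _
                  _ = M₁ * M₂ * (‖(𝓕 f : L2 d) ξ‖ₑ * ‖(𝓕 χ : L2 d) (dualAct h ξ)‖ₑ) := by ring
                  _ ≤ _ := by
                      gcongr
                      exact enorm_mul_le_add_sq _ _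
            _ = M₁ * M₂ * (N₁ + ENNReal.ofReal (absDet (transposeGL (h : GL (Fin d) ℝ)))⁻¹ *
                  N₂) := by
                rw [lintegral_const_mul' _ _ (ENNReal.mul_lt_top hM₁.1 hM₂.1).ne,
                  lintegral_add_left (hmf.enorm.pow_const 2),
                  lintegral_comp_act _ (fun ξ => ‖(𝓕 χ : L2 d) ξ‖ₑ ^ 2)]
            _ ≤ _ := by
                gcongr
                exact hC (Set.mem_image_of_mem _ hh)
        · rw [Set.indicator_of_notMem hh]
          refine le_of_eq (lintegral_eq_zero_of_ae_eq_zero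
            (Filter.Eventually.of_forall fun ξ => ?_))
          rcases hQ1 h hh ξ with h0 | h0 <;> simp [Function.uncurry, h0]
    _ = M₁ * M₂ * (N₁ + ENNReal.ofReal C * N₂) * Measure.haar Q := by
        rw [lintegral_indicator hQ.measurableSet, setLIntegral_const]
    _ < ⊤ := by
        refine ENNReal.mul_lt_top (ENNReal.mul_lt_top (ENNReal.mul_lt_top hM₁.1 hM₂.1)
          (ENNReal.add_lt_top.2 ⟨lintegral_enorm_sq_lt_top _,
            ENNReal.mul_lt_top ENNReal.ofReal_lt_top (lintegral_enorm_sq_lt_top _)⟩))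
          hQ.measure_lt_top

/-- The orthogonality relations. -/
theorem IsFreeOpenOrbit.integral_inner_waveletTransform (hO : IsFreeOpenOrbit H ξ₀ O s)
    (χ f : L2 d) {η g : 𝓢(E d, ℂ)} (hη : IsBandlimited O η) (hg : IsBandlimited O g) :
    ∫ p, inner ℂ (waveletTransform H χ f p) (waveletTransform H (toL2 η) (toL2 g) p)
      ∂(haarSemidirect H) = inner ℂ f (toL2 g) * orbitPairing H ξ₀ χ η := by
  have hW : Integrable (waveletTransform H (toL2 η) (toL2 g)) (haarSemidirect H) := by
    refine ⟨(measurable_waveletTransform _ _).aestronglyMeasurable, ?_⟩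
    have h1 := hO.weightedLIntegral_lt_top hη hg (w := fun _ => 1) measurable_const
      fun K _ => ⟨1, fun _ _ => le_rfl⟩
    simpa [weightedLIntegral, hasFiniteIntegral_iff_enorm] using h1
  have hint : Integrable (fun p => inner ℂ (waveletTransform H χ f p)
      (waveletTransform H (toL2 η) (toL2 g) p)) (haarSemidirect H) := by
    have hm := (measurable_waveletTransform (H := H) χ f).inner (𝕜 := ℂ)
      (measurable_waveletTransform (toL2 η) (toL2 g))
    refine (hW.norm.const_mul (‖χ‖ * ‖f‖)).mono' hm.aestronglyMeasurable
      (Filter.Eventually.of_forall fun p => (norm_inner_le_norm _ _).trans ?_)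
    refine mul_le_mul_of_nonneg_right ((norm_inner_le_norm _ _).trans_eq ?_) (norm_nonneg _)
    congr 1
    exact (quasiRegularₗᵢ p.1 (p.2 : GL (Fin d) ℝ)).norm_map χ
  have hmd : Measurable fun h : H => ENNReal.ofReal (absDet (h : GL (Fin d) ℝ))⁻¹ := by fun_prop
  rw [haarSemidirect] at hint ⊢
  rw [integral_prod_symm _ hint, integral_withDensity_eq_integral_toReal_smul hmd
    (Filter.Eventually.of_forall fun _ => ENNReal.ofReal_lt_top)]
  have h1 : ∀ h : H, (ENNReal.ofReal (absDet (h : GL (Fin d) ℝ))⁻¹).toReal •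
      ∫ x, inner ℂ (waveletTransform H χ f (x, h))
        (waveletTransform H (toL2 η) (toL2 g) (x, h)) =
      ∫ ξ, inner ℂ ((𝓕 f : L2 d) ξ) ((𝓕 g : 𝓢(E d, ℂ)) ξ) *
        inner ℂ ((𝓕 η : 𝓢(E d, ℂ)) (dualAct h ξ)) ((𝓕 χ : L2 d) (dualAct h ξ)) := by
    intro h
    rw [Coorbit.integral_inner_waveletTransform, smul_smul,
      ENNReal.toReal_ofReal (inv_pos.2 (absDet_pos _)).le, inv_mul_cancel₀ (absDet_pos _).ne',
      one_smul]
  -- After the exchange the integral over `h` no longer depends on `ξ ∈ O`; it comes out as the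
  -- constant `orbitPairing`, and Plancherel finishes.
  rw [integral_congr_ae (Filter.Eventually.of_forall h1),
    integral_integral_swap (hO.integrable_orbit_integrand χ f hη hg)]
  have h2 : ∀ᵐ ξ, ∫ h : H, inner ℂ ((𝓕 f : L2 d) ξ) ((𝓕 g : 𝓢(E d, ℂ)) ξ) *
      inner ℂ ((𝓕 η : 𝓢(E d, ℂ)) (dualAct h ξ)) ((𝓕 χ : L2 d) (dualAct h ξ)) ∂Measure.haar =
      inner ℂ ((𝓕 f : L2 d) ξ) ((𝓕 (toL2 g) : L2 d) ξ) * orbitPairing H ξ₀ χ η := by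
    filter_upwards [hO.ae_mem, coeFn_fourier_toL2 g] with ξ hξ hgξ
    rw [integral_const_mul, hgξ, orbitPairing, hO.integral_dualAct
      (fun ξ => inner ℂ ((𝓕 η : 𝓢(E d, ℂ)) ξ) ((𝓕 χ : L2 d) ξ)) hξ]
  rw [integral_congr_ae h2, integral_mul_const, ← L2.inner_def, Lp.inner_fourier_eq]

lemma IsFreeOpenOrbit.enorm_inner_mul_le (hO : IsFreeOpenOrbit H ξ₀ O s)
    (χ f : L2 d) {η g : 𝓢(E d, ℂ)} (hη : IsBandlimited O η) (hg : IsBandlimited O g) :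
    ‖inner ℂ f (toL2 g)‖ₑ * ‖orbitPairing H ξ₀ χ η‖ₑ ≤
      ∫⁻ p, ‖waveletTransform H χ f p‖ₑ * ‖waveletTransform H (toL2 η) (toL2 g) p‖ₑ
        ∂(haarSemidirect H) := by
  rw [← enorm_mul, ← hO.integral_inner_waveletTransform χ f hη hg]
  refine (enorm_integral_le_lintegral_enorm _).trans (lintegral_mono fun p => ?_)
  rw [RCLike.inner_apply, enorm_mul, RCLike.enorm_conj, mul_comm]

end Orbit

/-! ### Nonvanishing of the orthogonality constant -/

section Pairing

variable {d : ℕ} {H : Subgroup (GL (Fin d) ℝ)} [LocallyCompactSpace H]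
  {ξ₀ : E d} {O : Set (E d)} {s : E d → H}

/-- Square integrable functions are locally integrable on the orbit for the image of Haar
measure. -/
lemma IsFreeOpenOrbit.locallyIntegrableOn (hO : IsFreeOpenOrbit H ξ₀ O s) (X : L2 d) :
    LocallyIntegrableOn X O
      (Measure.map (fun h : H => dualAct h ξ₀) Measure.haar) := by
  have hmX : Measurable X := (Lp.stronglyMeasurable _).measurable
  have hmd : Measurable fun h : H => dualAct h ξ₀ := (continuous_dualAct_left ξ₀).measurable
  refine (locallyIntegrableOn_iff hO.isOpen.isLocallyClosed).2 fun K hKO hK => ?_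
  refine ⟨hmX.aestronglyMeasurable, ?_⟩
  rw [hasFiniteIntegral_iff_enorm, ← lintegral_indicator hK.measurableSet,
    lintegral_map (hmX.enorm.indicator hK.measurableSet) hmd]
  obtain ⟨r, hr, hrO⟩ := Metric.nhds_basis_closedBall.mem_iff.1 (hO.isOpen.mem_nhds hO.base_mem)
  set K₁ := Metric.closedBall ξ₀ r with hK₁
  have hcK₁ : IsCompact K₁ := isCompact_closedBall _ _
  have hpos : volume K₁ ≠ 0 := (Metric.measure_closedBall_pos _ _ hr).ne'
  have hfin : volume K₁ < ⊤ := hcK₁.measure_lt_top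
  obtain ⟨Q, hQ, hQ1⟩ := hO.exists_isCompact hcK₁ hK hrO hKO
  have hc : Continuous fun h : H => (absDet (transposeGL (h : GL (Fin d) ℝ)))⁻¹ :=
    Continuous.inv₀ (by fun_prop) fun h => (absDet_pos _).ne'
  obtain ⟨C, hC⟩ := (hQ.image hc).bddAbove
  set F : E d → ℝ≥0∞ := K.indicator fun a => ‖X a‖ₑ with hF
  have hFm : Measurable F := hmX.enorm.indicator hK.measurableSet
  set N := ∫⁻ ξ, ‖X ξ‖ₑ ^ 2 with hN
  -- No density of the image of Haar measure is computed. The orbit integral is the same at every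
  -- point of the small ball `K₁`, so it may be averaged over `K₁`; after exchanging integrals only
  -- `h` in a compact set contribute, each with a bounded Lebesgue integral.
  have key : (∫⁻ h : H, F (dualAct h ξ₀) ∂Measure.haar) * volume K₁ < ⊤ := by
    calc (∫⁻ h : H, F (dualAct h ξ₀) ∂Measure.haar) * volume K₁
        = ∫⁻ ξ in K₁, ∫⁻ h : H, F (dualAct h ξ) ∂Measure.haar := by
          rw [← setLIntegral_const]
          exact setLIntegral_congr_fun hcK₁.measurableSet fun ξ hξ =>
            (hO.lintegral_dualAct F (hrO hξ)).symm
      _ = ∫⁻ h : H, (∫⁻ ξ in K₁, F (dualAct h ξ)) ∂Measure.haar := by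
          have hm : Measurable (Function.uncurry fun (ξ : E d) (h : H) => F (dualAct h ξ)) :=
            measurable_uncurry_comp_dualAct (f := F) hFm
          exact lintegral_lintegral_swap hm.aemeasurable
      _ ≤ ∫⁻ h : H, Q.indicator (fun _ => volume K₁ + ENNReal.ofReal C * N) h
            ∂Measure.haar := by
          refine lintegral_mono fun h => ?_
          by_cases hh : h ∈ Q
          · rw [Set.indicator_of_mem hh]
            calc _ ≤ ∫⁻ ξ in K₁, (1 + ‖X (dualAct h ξ)‖ₑ ^ 2) := by
                  refine lintegral_mono fun ξ => ?_
                  refine (Set.indicator_le_self _ _ _).trans ?_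
                  simpa using enorm_mul_le_add_sq 1 ‖X (dualAct h ξ)‖ₑ
              _ ≤ volume K₁ + ∫⁻ ξ, ‖X (dualAct h ξ)‖ₑ ^ 2 := by
                  rw [lintegral_add_left measurable_const, setLIntegral_one]
                  gcongr
                  exact Measure.restrict_le_self
              _ ≤ _ := by
                  rw [lintegral_comp_act _ (fun ξ => ‖X ξ‖ₑ ^ 2)]
                  gcongr
                  exact hC (Set.mem_image_of_mem _ hh)
          · rw [Set.indicator_of_notMem hh]
            refine le_of_eq ?_
            rw [setLIntegral_congr_fun hcK₁.measurableSet (g := fun _ => 0) fun ξ hξ =>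
              Set.indicator_of_notMem (fun hmem => hh (hQ1 h ξ hξ hmem)) _]
            simp
      _ = (volume K₁ + ENNReal.ofReal C * N) * Measure.haar Q := by
          rw [lintegral_indicator hQ.measurableSet, setLIntegral_const]
      _ < ⊤ := ENNReal.mul_lt_top (ENNReal.add_lt_top.2 ⟨hfin,
          ENNReal.mul_lt_top ENNReal.ofReal_lt_top (lintegral_enorm_sq_lt_top _)⟩)
          hQ.measure_lt_top
  by_contra hcon
  rw [not_lt, top_le_iff] at hcon
  rw [hcon, ENNReal.top_mul hpos] at key
  exact lt_irrefl _ key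

/-- The image of Haar measure on the orbit has the same null sets as Lebesgue measure. -/
lemma IsFreeOpenOrbit.ae_eq_zero (hO : IsFreeOpenOrbit H ξ₀ O s) {X : E d → ℂ}
    (hX : Measurable X) (h0 : ∀ᵐ h : H ∂Measure.haar, X (dualAct h ξ₀) = 0) :
    ∀ᵐ ξ, X ξ = 0 := by
  have h1 : ∫⁻ h : H, ‖X (dualAct h ξ₀)‖ₑ ∂Measure.haar = 0 :=
    lintegral_eq_zero_of_ae_eq_zero (h0.mono fun h hh => by simp [hh])
  -- The same averaging, now over the whole space: exchanging integrals factors this into `∫ |X|`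
  -- times the Haar integral of the positive function `|det h|⁻¹`, which cannot vanish.
  have h2 : ∫⁻ ξ, ∫⁻ h : H, ‖X (dualAct h ξ)‖ₑ ∂Measure.haar = 0 := by
    refine lintegral_eq_zero_of_ae_eq_zero (hO.ae_mem.mono fun ξ hξ => ?_)
    exact (hO.lintegral_dualAct (fun ξ => ‖X ξ‖ₑ) hξ).trans h1
  have hm : Measurable (Function.uncurry fun (ξ : E d) (h : H) => ‖X (dualAct h ξ)‖ₑ) :=
    measurable_uncurry_comp_dualAct (f := fun ξ => ‖X ξ‖ₑ) hX.enorm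
  rw [lintegral_lintegral_swap hm.aemeasurable] at h2
  simp_rw [lintegral_comp_act _ (fun ξ => ‖X ξ‖ₑ)] at h2
  have h3 : ∫⁻ ξ, ‖X ξ‖ₑ = 0 := by
    by_contra hne
    have hm : Measurable fun h : H => ENNReal.ofReal
        (absDet (transposeGL (h : GL (Fin d) ℝ)))⁻¹ := Measurable.ennreal_ofReal
      (Continuous.measurable (Continuous.inv₀ (by fun_prop) fun h => (absDet_pos _).ne'))
    rw [lintegral_mul_const _ hm, mul_eq_zero, or_iff_left hne, lintegral_eq_zero_iff hm] at h2
    have h4 : ∀ᵐ h : H ∂Measure.haar, False := h2.mono fun h hh => by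
      have := ENNReal.ofReal_eq_zero.1 hh
      exact this.not_gt (inv_pos.2 (absDet_pos _))
    have : NeZero (Measure.haar : Measure H) := inferInstance
    exact this.out (by simpa [ae_iff] using h4)
  rw [lintegral_eq_zero_iff hX.enorm] at h3
  exact h3.mono fun ξ hξ => by simpa using hξ

/-- Every nonzero vector pairs nontrivially with some bandlimited function. -/
theorem IsFreeOpenOrbit.exists_orbitPairing_ne_zero (hO : IsFreeOpenOrbit H ξ₀ O s) {χ : L2 d}
    (hχ : χ ≠ 0) : ∃ η : 𝓢(E d, ℂ), IsBandlimited O η ∧ orbitPairing H ξ₀ χ η ≠ 0 := by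
  by_contra! hcon
  have hmd : Measurable fun h : H => dualAct h ξ₀ := (continuous_dualAct_left ξ₀).measurable
  have hmχ : Measurable (𝓕 χ : L2 d) := (Lp.stronglyMeasurable _).measurable
  -- The fundamental lemma of the calculus of variations on `O`, for the image of Haar measure: each
  -- smooth test function `θ` is the Fourier transform of a bandlimited function, whose pairing
  -- vanishes by assumption.
  have h1 := hO.isOpen.ae_eq_zero_of_integral_contDiff_smul_eq_zero
    (hO.locallyIntegrableOn (𝓕 χ : L2 d)) (fun θ hθ hθc hθO => by
      have e1 : HasCompactSupport fun ξ => (θ ξ : ℂ) := hθc.comp_left Complex.ofReal_zero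
      have e2 : ContDiff ℝ ∞ fun ξ => (θ ξ : ℂ) := Complex.ofRealCLM.contDiff.comp hθ
      have e3 : (𝓕 (𝓕⁻ (e1.toSchwartzMap e2)) : 𝓢(E d, ℂ)) = e1.toSchwartzMap e2 :=
        fourier_fourierInv_eq _
      have e4 : IsBandlimited O (𝓕⁻ (e1.toSchwartzMap e2)) := by
        refine ⟨by rw [e3]; exact e1, ?_⟩
        rw [e3]
        exact (closure_mono fun ξ hξ => by
          intro h0
          exact hξ (by simp [h0])).trans hθO
      have e5 := hcon _ e4
      rw [orbitPairing, e3] at e5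
      have hm : Measurable fun ξ => θ ξ • (𝓕 χ : L2 d) ξ := hθ.continuous.measurable.smul hmχ
      rw [integral_map hmd.aemeasurable hm.aestronglyMeasurable, ← e5]
      refine integral_congr_ae (Filter.Eventually.of_forall fun h => ?_)
      have e6 : (e1.toSchwartzMap e2) (dualAct h ξ₀) = (θ (dualAct h ξ₀) : ℂ) := rfl
      beta_reduce
      rw [e6, RCLike.inner_apply, Complex.conj_ofReal, Complex.real_smul, mul_comm])
  have h2 : ∀ᵐ h : H ∂Measure.haar, (𝓕 χ : L2 d) (dualAct h ξ₀) = 0 :=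
    (ae_of_ae_map hmd.aemeasurable h1).mono fun h hh => hh (hO.mem h)
  have h3 := hO.ae_eq_zero hmχ h2
  have h4 : (𝓕 χ : L2 d) = 0 := (Lp.eq_zero_iff_ae_eq_zero).2 h3
  have h5 := Lp.norm_fourier_eq χ
  rw [h4, norm_zero] at h5
  exact hχ (norm_eq_zero.1 h5.symm)

end Pairing

/-! ### Change of window, and criteria for membership in coorbit spaces -/

section CoorbitSpaces

variable {d : ℕ} {H : Subgroup (GL (Fin d) ℝ)} {ξ₀ : E d} {O : Set (E d)}
  {s : E d → H} {v v₀ : H → ℝ}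

lemma IsModerate.apply_mul_le (hv : IsModerate H v v₀) (a b : H) :
    v (a * b) ≤ v a * (v₀ 1 * v₀ b) := by
  have h1 := hv.moderate 1 a b
  rw [one_mul] at h1
  exact h1.trans_eq (by ring)

lemma IsModerate.bounded_const_mul (hv : IsModerate H v v₀) {K : Set H} (hK : IsCompact K) :
    ∃ C, ∀ h ∈ K, v₀ 1 * v₀ h ≤ C := by
  obtain ⟨C, hC⟩ := hv.bounded_on_compact K hK
  exact ⟨v₀ 1 * C, fun h hh => mul_le_mul_of_nonneg_left (hC h hh) (hv.pos 1).le⟩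

/-- The wavelet transform of an integrable function controls its Fourier transform along
the orbit. -/
lemma enorm_fourier_mul_le (η ψ : 𝓢(E d, ℂ)) (h : H) (ξ : E d) :
    ENNReal.ofReal (absDet (h : GL (Fin d) ℝ) ^ (1 / 2 : ℝ)) *
        (‖(𝓕 η : 𝓢(E d, ℂ)) (dualAct h ξ)‖ₑ * ‖(𝓕 ψ : 𝓢(E d, ℂ)) ξ‖ₑ) ≤
      ∫⁻ x, ‖waveletTransform H (toL2 η) (toL2 ψ) (x, h)‖ₑ := by
  have h1 := fourier_waveletTransform η ψ h ξ
  have h2 : ‖𝓕 (fun x => waveletTransform H (toL2 η) (toL2 ψ) (x, h)) ξ‖ₑ ≤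
      ∫⁻ x, ‖waveletTransform H (toL2 η) (toL2 ψ) (x, h)‖ₑ := by
    rw [Real.fourier_eq]
    refine (enorm_integral_le_lintegral_enorm _).trans_eq (lintegral_congr fun x => ?_)
    rw [← ofReal_norm, Circle.norm_smul, ofReal_norm]
  refine le_trans (le_of_eq ?_) h2
  rw [h1, waveletSymbol, enorm_mul, RCLike.inner_apply, enorm_mul, RCLike.enorm_conj,
    ← ofReal_norm ((absDet (h : GL (Fin d) ℝ) ^ (1 / 2 : ℝ) : ℝ) : ℂ), Complex.norm_real,
    Real.norm_of_nonneg (Real.rpow_nonneg (absDet_pos _).le _),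
    mul_comm ‖(𝓕 ψ : 𝓢(E d, ℂ)) ξ‖ₑ]

variable [LocallyCompactSpace H]

/-- A weighted convolution inequality for functions dominated by twisted convolutions. -/
lemma weightedLIntegral_lt_top_of_le (hv : IsModerate H v v₀) (hv0 : ∀ h, 0 ≤ v h)
    (hvm : Measurable v) {F A B : E d × H → ℂ} {c : ℝ≥0∞} (hc : c ≠ 0)
    (hA : Measurable A) (hB : Measurable B)
    (hF : ∀ z, ‖F z‖ₑ * c ≤ ∫⁻ y, ‖A y‖ₑ * ‖B (gmul (ginv y) z)‖ₑ ∂(haarSemidirect H))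
    (hAv : weightedLIntegral H v A < ⊤)
    (hBv : weightedLIntegral H (fun h => v₀ 1 * v₀ h) B < ⊤) (hct : c ≠ ⊤) :
    weightedLIntegral H v F < ⊤ := by
  have h1 : weightedLIntegral H v F * c < ⊤ := by
    rw [weightedLIntegral, ← lintegral_mul_const' _ _ hct]
    refine lt_of_le_of_lt ?_ (ENNReal.mul_lt_top hAv hBv)
    refine le_trans (lintegral_mono fun z => ?_) (lintegral_convolution_le hv0 hvm
      (measurable_const.mul hv.measurable) hv.apply_mul_le hA.enorm hB.enorm)
    rw [mul_assoc]
    gcongr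
    exact hF z
  by_contra hcon
  rw [not_lt, top_le_iff] at hcon
  rw [hcon, ENNReal.top_mul hc] at h1
  exact lt_irrefl _ h1

lemma weightedLIntegral_mono {u w : H → ℝ} (huw : ∀ h, u h ≤ w h) (F : E d × H → ℂ) :
    weightedLIntegral H u F ≤ weightedLIntegral H w F := by
  refine lintegral_mono fun p => ?_
  gcongr
  exact huw _

lemma mem_H1w_iff {w : H → ℝ} {χ f : L2 d} :
    f ∈ H1w H w χ ↔ MemWeightedL1 H w (waveletTransform H χ f) := Iff.rfl

lemma mem_analyzingVectors_iff {w : H → ℝ} {χ : L2 d} :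
    χ ∈ analyzingVectors H w ↔ MemWeightedL1 H w (waveletTransform H χ χ) := Iff.rfl

lemma IsModerate.weightedLIntegral_lt_top (hv : IsModerate H v v₀) {F : E d × H → ℂ}
    (hFm : Measurable F) (hF : MemWeightedL1 H (controlWeight H v₀) F) :
    weightedLIntegral H (controlWeight H v₀) F < ⊤ :=
  (memWeightedL1_iff hv.controlWeight_nonneg hv.measurable_controlWeight hFm).1 hF

/-- The extended wavelet transform of `f ∈ L²` is the wavelet transform of `f`. -/
lemma IsModerate.extendedWaveletTransform_eq (hv : IsModerate H v v₀) {χ : L2 d}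
    (hχ : χ ∈ analyzingVectors H (controlWeight H v₀)) {f : L2 d}
    {F : H1w H (controlWeight H v₀) χ →ₛₗ[starRingEnd ℂ] ℂ}
    (hF : ∀ u : H1w H (controlWeight H v₀) χ, F u = inner ℂ (u : L2 d) f) :
    extendedWaveletTransform H (controlWeight H v₀) χ F = waveletTransform H χ f := by
  funext p
  have h1 : quasiRegular p.1 (p.2 : GL (Fin d) ℝ) χ ∈ H1w H (controlWeight H v₀) χ :=
    hv.rep_mem_H1w hχ p
  rw [extendedWaveletTransform, dif_pos h1, hF]
  rfl

/-- The antilinear functional `u ↦ ⟨f, u⟩` on a subspace of `L²`. -/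
def innerFunctional (K : Submodule ℂ (L2 d)) (f : L2 d) : K →ₛₗ[starRingEnd ℂ] ℂ where
  toFun u := inner ℂ (u : L2 d) f
  map_add' u u' := by simp [inner_add_left]
  map_smul' c u := by simp [inner_smul_left]

/-- Bandlimited functions define bounded functionals on `H¹_w`. -/
lemma IsFreeOpenOrbit.norm_inner_le (hO : IsFreeOpenOrbit H ξ₀ O s) (hv : IsModerate H v v₀)
    {χ u : L2 d} {η ψ : 𝓢(E d, ℂ)} (hη : IsBandlimited O η)
    (hC : orbitPairing H ξ₀ χ η ≠ 0) (hψ : IsBandlimited O ψ)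
    (hu : MemWeightedL1 H (controlWeight H v₀) (waveletTransform H χ u)) :
    ‖inner ℂ u (toL2 ψ)‖ ≤ ‖toL2 η‖ * ‖toL2 ψ‖ * ‖orbitPairing H ξ₀ χ η‖⁻¹ *
      weightedL1Norm H (controlWeight H v₀) (waveletTransform H χ u) := by
  have h1 := hO.enorm_inner_mul_le χ u hη hψ
  set C := orbitPairing H ξ₀ χ η with hCdef
  have h2 : ∫⁻ p, ‖waveletTransform H χ u p‖ₑ * ‖waveletTransform H (toL2 η) (toL2 ψ) p‖ₑ
      ∂(haarSemidirect H) ≤ ENNReal.ofReal (weightedL1Norm H (controlWeight H v₀)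
        (waveletTransform H χ u)) * ENNReal.ofReal (‖toL2 η‖ * ‖toL2 ψ‖) := by
    rw [ofReal_weightedL1Norm hv.controlWeight_nonneg hu, weightedLIntegral,
      ← lintegral_mul_const' _ _ ENNReal.ofReal_ne_top]
    -- Boundedness of `W_η ψ` by `‖η‖ ‖ψ‖` is enough here, because the control weight is at least
    -- one.
    refine lintegral_mono fun p => ?_
    refine mul_le_mul' ?_ (enorm_waveletTransform_le _ _ _)
    refine le_mul_of_one_le_left zero_le ?_
    rw [← ENNReal.ofReal_one]
    exact ENNReal.ofReal_le_ofReal (hv.one_le_controlWeight _)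
  have h3 : 0 ≤ weightedL1Norm H (controlWeight H v₀) (waveletTransform H χ u) :=
    integral_nonneg fun _ => norm_nonneg _
  have h4 := h1.trans h2
  rw [← ofReal_norm, ← ofReal_norm, ← ENNReal.ofReal_mul (norm_nonneg _),
    ← ENNReal.ofReal_mul h3, ENNReal.ofReal_le_ofReal_iff (by positivity)] at h4
  have hC' : 0 < ‖C‖ := norm_pos_iff.2 hC
  calc ‖inner ℂ u (toL2 ψ)‖ = ‖inner ℂ u (toL2 ψ)‖ * ‖C‖ * ‖C‖⁻¹ := by
        field_simp
    _ ≤ _ := by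
        refine (mul_le_mul_of_nonneg_right h4 (inv_nonneg.2 hC'.le)).trans_eq ?_
        ring

/-- Wavelet transforms of bandlimited functions with respect to analyzing vectors belong
to `L¹_v`. -/
lemma IsFreeOpenOrbit.weightedLIntegral_bandlimited_lt_top (hO : IsFreeOpenOrbit H ξ₀ O s)
    (hv : IsModerate H v v₀) (hv0 : ∀ h, 0 ≤ v h) (hvc : Continuous v) {χ : L2 d}
    (hχ : χ ∈ analyzingVectors H (controlWeight H v₀)) {η ψ : 𝓢(E d, ℂ)} (hη : IsBandlimited O η)
    (hC : orbitPairing H ξ₀ χ η ≠ 0) (hψ : IsBandlimited O ψ) :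
    weightedLIntegral H v (waveletTransform H χ (toL2 ψ)) < ⊤ := by
  -- The orthogonality relation applied to `f = σ(z)χ` and `g = ψ` bounds `|W_χ ψ(z)|` by the
  -- convolution of `|W_η ψ|` with `|W_χ χ|`.
  refine weightedLIntegral_lt_top_of_le hv hv0 hvc.measurable (c := ‖orbitPairing H ξ₀ χ η‖ₑ)
    (A := waveletTransform H (toL2 η) (toL2 ψ)) (B := waveletTransform H χ χ)
    (by simpa using hC) (measurable_waveletTransform _ _) (measurable_waveletTransform _ _)
    (fun z => ?_) ?_ ?_ enorm_ne_top
  · refine (hO.enorm_inner_mul_le χ (rep z χ) hη hψ).trans_eq ?_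
    refine lintegral_congr fun y => ?_
    have h1 : ‖waveletTransform H χ (rep z χ) y‖ₑ =
        ‖waveletTransform H χ χ (gmul (ginv z) y)‖ₑ := by
      rw [← waveletTransform_rep_right χ χ z, gmul_ginv_cancel_left]
    rw [h1, enorm_waveletTransform_ginv_gmul, mul_comm]
  · refine hO.weightedLIntegral_lt_top hη hψ hvc.measurable fun K hK => ?_
    obtain ⟨M, hM⟩ := (hK.image hvc).bddAbove
    exact ⟨M, fun h hh => hM (Set.mem_image_of_mem _ hh)⟩
  · exact (weightedLIntegral_mono hv.mul_le_controlWeight _).trans_lt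
      (hv.weightedLIntegral_lt_top (measurable_waveletTransform _ _)
        (mem_analyzingVectors_iff.1 hχ))

/-- Bandlimited functions belong to all coorbit spaces. -/
theorem IsFreeOpenOrbit.memCoorbit (hO : IsFreeOpenOrbit H ξ₀ O s) (hv : IsModerate H v v₀)
    (hv0 : ∀ h, 0 ≤ v h) (hvc : Continuous v) {χ : L2 d}
    (hχ : χ ∈ analyzingVectors H (controlWeight H v₀)) (hχ0 : χ ≠ 0) {ψ : 𝓢(E d, ℂ)}
    (hψ : IsBandlimited O ψ) : MemCoorbit H v (controlWeight H v₀) χ (toL2 ψ) := by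
  obtain ⟨η, hη, hC⟩ := hO.exists_orbitPairing_ne_zero hχ0
  have hF : ∀ u : H1w H (controlWeight H v₀) χ,
      innerFunctional (H1w H (controlWeight H v₀) χ) (toL2 ψ) u = inner ℂ (u : L2 d) (toL2 ψ) :=
    fun _ => rfl
  have h1 : innerFunctional (H1w H (controlWeight H v₀) χ) (toL2 ψ) ∈
      reservoir H (controlWeight H v₀) χ := by
    refine ⟨‖toL2 η‖ * ‖toL2 ψ‖ * ‖orbitPairing H ξ₀ χ η‖⁻¹, fun u => ?_⟩
    rw [hF]
    exact hO.norm_inner_le hv hη hC hψ (mem_H1w_iff.1 u.2)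
  have h2 : MemWeightedL1 H v (extendedWaveletTransform H (controlWeight H v₀) χ
      (innerFunctional (H1w H (controlWeight H v₀) χ) (toL2 ψ))) := by
    rw [hv.extendedWaveletTransform_eq hχ hF]
    exact (memWeightedL1_iff hv0 hvc.measurable (measurable_waveletTransform _ _)).2
      (hO.weightedLIntegral_bandlimited_lt_top hv hv0 hvc hχ hη hC hψ)
  exact ⟨_, ⟨h1, h2⟩, hF⟩

/-- Membership in a coorbit space is detected by wavelet transforms with bandlimited analyzing
vectors. -/
theorem IsFreeOpenOrbit.exists_bandlimited_of_memCoorbit (hO : IsFreeOpenOrbit H ξ₀ O s)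
    (hv : IsModerate H v v₀) (hv0 : ∀ h, 0 ≤ v h) (hvm : Measurable v) {χ : L2 d}
    (hχ : χ ∈ analyzingVectors H (controlWeight H v₀)) (hχ0 : χ ≠ 0) {f : L2 d}
    (hf : MemCoorbit H v (controlWeight H v₀) χ f) :
    ∃ η : 𝓢(E d, ℂ), orbitPairing H ξ₀ χ η ≠ 0 ∧
      weightedLIntegral H v (waveletTransform H (toL2 η) f) < ⊤ := by
  obtain ⟨η, hη, hC⟩ := hO.exists_orbitPairing_ne_zero hχ0
  obtain ⟨F, ⟨_, hF1⟩, hF⟩ := hf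
  rw [hv.extendedWaveletTransform_eq hχ hF, memWeightedL1_iff hv0 hvm
    (measurable_waveletTransform _ _)] at hF1
  refine ⟨η, hC, ?_⟩
  refine weightedLIntegral_lt_top_of_le hv hv0 hvm (c := ‖orbitPairing H ξ₀ χ η‖ₑ)
      (A := waveletTransform H χ f) (B := waveletTransform H (toL2 η) (toL2 η))
      (by simpa using hC) (measurable_waveletTransform _ _) (measurable_waveletTransform _ _)
      (fun z => ?_) hF1 (hO.weightedLIntegral_lt_top hη hη (measurable_const.mul hv.measurable)
        fun K hK => hv.bounded_const_mul hK) enorm_ne_top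
  -- With `σ(z)⁻¹f` against `η` itself, the inner product is `W_η f(z)` up to conjugation;
  -- translating by `z⁻¹` then shows the convolution of `|W_χ f|` with `|W_η η|`.
  have h1 := hO.enorm_inner_mul_le χ (rep (ginv z) f) hη hη
  have h2 : ‖inner ℂ (rep (ginv z) f) (toL2 η)‖ₑ = ‖waveletTransform H (toL2 η) f z‖ₑ := by
    rw [waveletTransform_apply, inner_rep_left z (toL2 η) f,
      ← inner_conj_symm (𝕜 := ℂ) (toL2 η) (rep (ginv z) f), RCLike.enorm_conj (K := ℂ)]
  rw [← h2]
  refine h1.trans_eq ?_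
  have hm : Measurable fun y => ‖waveletTransform H χ (rep (ginv z) f) y‖ₑ *
      ‖waveletTransform H (toL2 η) (toL2 η) y‖ₑ :=
    (measurable_waveletTransform _ _).enorm.mul (measurable_waveletTransform _ _).enorm
  rw [← lintegral_gmul_left (ginv z) hm]
  refine lintegral_congr fun y => ?_
  rw [waveletTransform_rep_right, enorm_waveletTransform_ginv_gmul]

lemma toL2_zero : toL2 (0 : 𝓢(E d, ℂ)) = 0 :=
  (SchwartzMap.toLpCLM ℂ ℂ 2 (volume : Measure (E d))).map_zero

/-- Bandlimited functions are analyzing vectors. -/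
theorem IsFreeOpenOrbit.exists_analyzing_ne_zero (hO : IsFreeOpenOrbit H ξ₀ O s)
    (hv : IsModerate H v v₀) [Nontrivial (L2 d)] :
    ∃ χ ∈ analyzingVectors H (controlWeight H v₀), χ ≠ 0 := by
  obtain ⟨χ, hχ⟩ := exists_ne (0 : L2 d)
  obtain ⟨η, hη, hC⟩ := hO.exists_orbitPairing_ne_zero hχ
  refine ⟨toL2 η, ?_, ?_⟩
  · exact (memWeightedL1_iff hv.controlWeight_nonneg hv.measurable_controlWeight
      (measurable_waveletTransform _ _)).2 (hO.weightedLIntegral_lt_top hη hη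
        hv.measurable_controlWeight fun K hK => hv.controlWeight_bounded hK)
  · intro h0
    have h1 : η = 0 := SchwartzMap.injective_toLp 2 volume (h0.trans toL2_zero.symm)
    apply hC
    have h2 : (𝓕 (0 : 𝓢(E d, ℂ)) : 𝓢(E d, ℂ)) = 0 := fourier_zero
    simp [orbitPairing, h1, h2]

/-- If the Fourier transform of `ψ` is `1` at `ξ ∈ O`, then the `L¹_v`-norm of its wavelet transform
is bounded below by a multiple of a power of the determinant of the group element belonging
to `ξ`. -/
lemma IsFreeOpenOrbit.le_weightedLIntegral (hO : IsFreeOpenOrbit H ξ₀ O s) {r : ℝ}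
    (hv : ∀ h, v h = absDet (h : GL (Fin d) ℝ) ^ r) (η ψ : 𝓢(E d, ℂ)) {ξ : E d} (hξ : ξ ∈ O)
    (hψ : (𝓕 ψ : 𝓢(E d, ℂ)) ξ = 1) :
    ENNReal.ofReal (absDet (s ξ : GL (Fin d) ℝ) ^ (1 / 2 - r)) *
        ∫⁻ h : H, ENNReal.ofReal (absDet (h : GL (Fin d) ℝ) ^ (r - 1 / 2)) *
          ‖(𝓕 η : 𝓢(E d, ℂ)) (dualAct h ξ₀)‖ₑ ∂Measure.haar ≤
      weightedLIntegral H v (waveletTransform H (toL2 η) (toL2 ψ)) := by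
  have hvm : Measurable v := by
    have h1 : v = fun h : H => absDet (h : GL (Fin d) ℝ) ^ r := funext hv
    rw [h1]
    exact Measurable.pow_const (Continuous.measurable (by fun_prop)) _
  have hm : Measurable fun p : E d × H => ENNReal.ofReal (v p.2) *
      ‖waveletTransform H (toL2 η) (toL2 ψ) p‖ₑ :=
    (hvm.comp measurable_snd).ennreal_ofReal.mul (measurable_waveletTransform _ _).enorm
  -- Left translation by `s ξ` moves the base point to `ξ` and multiplies the determinant power by
  -- `|det s(ξ)|^{r - 1/2}`, which the prefactor cancels. Of the exponent `r - 1/2`, `r` comes from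
  -- `v`, `-1` from the measure and `1/2` from the symbol.
  rw [weightedLIntegral, lintegral_haarSemidirect hm,
    ← lintegral_mul_left_eq_self (fun h : H => ENNReal.ofReal
      (absDet (h : GL (Fin d) ℝ) ^ (r - 1 / 2)) * ‖(𝓕 η : 𝓢(E d, ℂ)) (dualAct h ξ₀)‖ₑ) (s ξ),
    ← lintegral_const_mul' _ _ ENNReal.ofReal_ne_top]
  refine lintegral_mono fun h => ?_
  have hs := absDet_pos (s ξ : GL (Fin d) ℝ)
  have hh := absDet_pos (h : GL (Fin d) ℝ)
  dsimp only
  rw [lintegral_const_mul' _ _ ENNReal.ofReal_ne_top, dualAct_mul, hO.dualAct_section ξ hξ]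
  calc _ = ENNReal.ofReal (absDet (h : GL (Fin d) ℝ))⁻¹ * (ENNReal.ofReal (v h) *
        (ENNReal.ofReal (absDet (h : GL (Fin d) ℝ) ^ (1 / 2 : ℝ)) *
        (‖(𝓕 η : 𝓢(E d, ℂ)) (dualAct h ξ)‖ₑ * ‖(𝓕 ψ : 𝓢(E d, ℂ)) ξ‖ₑ))) := by
        rw [hψ, enorm_one, mul_one]
        simp only [← mul_assoc]
        rw [← ENNReal.ofReal_mul (by positivity), ← ENNReal.ofReal_mul (by positivity),
          ← ENNReal.ofReal_mul (by rw [hv]; positivity), hv]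
        congr 2
        rw [Subgroup.coe_mul, absDet_mul, Real.mul_rpow hs.le hh.le, ← mul_assoc,
          ← Real.rpow_add hs, ← Real.rpow_neg_one, ← Real.rpow_add hh, ← Real.rpow_add hh]
        ring_nf
        simp
    _ ≤ _ := by
        gcongr
        exact enorm_fourier_mul_le η ψ h ξ

/-- If the integral vanished, `η̂` would vanish almost everywhere along the orbit, and so would the
integrand of the pairing. -/
lemma lintegral_ne_zero_of_orbitPairing_ne_zero {χ : L2 d} {η : 𝓢(E d, ℂ)}
    (hC : orbitPairing H ξ₀ χ η ≠ 0) (r : ℝ) :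
    ∫⁻ h : H, ENNReal.ofReal (absDet (h : GL (Fin d) ℝ) ^ r) *
      ‖(𝓕 η : 𝓢(E d, ℂ)) (dualAct h ξ₀)‖ₑ ∂Measure.haar ≠ 0 := by
  intro h0
  have h1 : Measurable fun h : H => absDet (h : GL (Fin d) ℝ) ^ r :=
    Measurable.pow_const (Continuous.measurable (by fun_prop)) _
  have h2 : Measurable fun h : H => (𝓕 η : 𝓢(E d, ℂ)) (dualAct h ξ₀) :=
    ((𝓕 η : 𝓢(E d, ℂ)).continuous.comp (continuous_dualAct_left ξ₀)).measurable
  have h5 : Measurable fun h : H => ENNReal.ofReal (absDet (h : GL (Fin d) ℝ) ^ r) *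
      ‖(𝓕 η : 𝓢(E d, ℂ)) (dualAct h ξ₀)‖ₑ := h1.ennreal_ofReal.mul h2.enorm
  rw [lintegral_eq_zero_iff h5] at h0
  refine hC (integral_eq_zero_of_ae (h0.mono fun h hh => ?_))
  have h3 : (𝓕 η : 𝓢(E d, ℂ)) (dualAct h ξ₀) = 0 := by
    rcases mul_eq_zero.1 hh with h4 | h4
    · exact absurd (ENNReal.ofReal_eq_zero.1 h4) (Real.rpow_pos_of_pos (absDet_pos _) _).not_ge
    · simpa using h4
  simp [h3]

/-- A Schwartz function whose Fourier transform is `1` at points of the orbit whose group elements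
have arbitrarily small determinant does not belong to the coorbit space with weight `|det|^r`,
`r > 1/2`. -/
theorem IsFreeOpenOrbit.not_memCoorbit (hO : IsFreeOpenOrbit H ξ₀ O s) {r : ℝ}
    (hr : 1 / 2 < r) (hvr : ∀ h, v h = absDet (h : GL (Fin d) ℝ) ^ r)
    (hv : IsModerate H v v₀) {χ : L2 d} (hχ : χ ∈ analyzingVectors H (controlWeight H v₀))
    (hχ0 : χ ≠ 0) {ψ : 𝓢(E d, ℂ)}
    (hψ : ∀ ε > 0, ∃ ξ ∈ O, (𝓕 ψ : 𝓢(E d, ℂ)) ξ = 1 ∧ absDet (s ξ : GL (Fin d) ℝ) < ε) :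
    ¬ MemCoorbit H v (controlWeight H v₀) χ (toL2 ψ) := by
  intro hmem
  have hv0 : ∀ h, 0 ≤ v h := fun h => by
    rw [hvr]; exact Real.rpow_nonneg (absDet_pos _).le _
  have hvm : Measurable v := by
    have h1 : v = fun h : H => absDet (h : GL (Fin d) ℝ) ^ r := funext hvr
    rw [h1]
    exact Measurable.pow_const (Continuous.measurable (by fun_prop)) _
  obtain ⟨η, hC, hη⟩ := hO.exists_bandlimited_of_memCoorbit hv hv0 hvm hχ hχ0 hmem
  set D := ∫⁻ h : H, ENNReal.ofReal (absDet (h : GL (Fin d) ℝ) ^ (r - 1 / 2)) *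
      ‖(𝓕 η : 𝓢(E d, ℂ)) (dualAct h ξ₀)‖ₑ ∂Measure.haar with hD
  have hD0 : D ≠ 0 := lintegral_ne_zero_of_orbitPairing_ne_zero hC _
  set M := weightedLIntegral H v (waveletTransform H (toL2 η) (toL2 ψ)) with hM
  have key : ∀ t : ℝ, 0 < t → ENNReal.ofReal t * D ≤ M := by
    intro t ht
    -- The exponent `1/2 - r` is negative, so a determinant below `t ^ (1 / (1/2 - r))` has its
    -- power `1/2 - r` at least `t`.
    obtain ⟨ξ, hξ, hψξ, hdet⟩ := hψ (t ^ (1 / (1 / 2 - r))) (Real.rpow_pos_of_pos ht _)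
    refine le_trans ?_ (hO.le_weightedLIntegral hvr η ψ hξ hψξ)
    gcongr
    have h1 := Real.rpow_le_rpow_of_nonpos (absDet_pos _) hdet.le
      (by linarith : 1 / 2 - r ≤ 0)
    rwa [← Real.rpow_mul ht.le, one_div_mul_cancel (by linarith), Real.rpow_one] at h1
  -- Finiteness of `D` is read off from the bound itself: with `t = 1`, an infinite `D` would force
  -- `M` to be infinite.
  have hDt : D ≠ ⊤ := by
    intro hDt
    have h1 := key 1 one_pos
    rw [ENNReal.ofReal_one, one_mul, hDt] at h1
    exact absurd hη (not_lt.2 h1)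
  have hDpos : 0 < D.toReal := ENNReal.toReal_pos hD0 hDt
  -- This `t` makes the lower bound equal to `M + 1`.
  have h1 := key ((M.toReal + 1) / D.toReal) (by positivity)
  have h2 : ENNReal.ofReal ((M.toReal + 1) / D.toReal) * D = ENNReal.ofReal (M.toReal + 1) := by
    conv_lhs => rw [← ENNReal.ofReal_toReal hDt]
    rw [ENNReal.toReal_ofReal hDpos.le, ← ENNReal.ofReal_mul (by positivity),
      div_mul_cancel₀ _ hDpos.ne']
  rw [h2, ENNReal.ofReal_le_iff_le_toReal hη.ne] at h1
  linarith

end CoorbitSpaces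

/-! ### Orbits of conjugated groups -/

section Conjugation

variable {d : ℕ} {H : Subgroup (GL (Fin d) ℝ)} {ξ₀ : E d} {O : Set (E d)} {s : E d → H}

lemma mem_conjGroup_iff (g h : GL (Fin d) ℝ) : h ∈ conjGroup H g ↔ g * h * g⁻¹ ∈ H := Iff.rfl

/-- The section of the orbit map of a conjugated group. -/
def conjSection (g : GL (Fin d) ℝ) (s : E d → H) (ξ : E d) : conjGroup H g :=
  ⟨g⁻¹ * (s (act (transposeGL g)⁻¹ ξ) : GL (Fin d) ℝ) * g, by
    rw [mem_conjGroup_iff]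
    simp [mul_assoc]⟩

lemma dualAct_conjGroup (g : GL (Fin d) ℝ) (h : conjGroup H g) (ξ : E d) :
    dualAct h (act (transposeGL g) ξ) =
      act (transposeGL g) (dualAct (⟨g * h * g⁻¹, h.2⟩ : H) ξ) := by
  simp only [dualAct, ← act_mul, transposeGL_mul, transposeGL_inv]
  simp [← mul_assoc]

/-- The dual action of `g⁻¹Hg` is that of `H` transported by `gᵀ`, so base point, orbit and section
are all carried along. -/
lemma IsFreeOpenOrbit.conj (hO : IsFreeOpenOrbit H ξ₀ O s) (g : GL (Fin d) ℝ) :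
    IsFreeOpenOrbit (conjGroup H g) (act (transposeGL g) ξ₀) (act (transposeGL g)⁻¹ ⁻¹' O)
      (conjSection g s) where
  isOpen := hO.isOpen.preimage (continuous_act _)
  conull := (quasiMeasurePreserving_act (transposeGL g)⁻¹).preimage_null hO.conull
  mem h := by
    rw [Set.mem_preimage, dualAct_conjGroup, act_inv_act]
    exact hO.mem _
  dualAct_section ξ hξ := by
    rw [dualAct_conjGroup]
    have h1 : (⟨g * (conjSection g s ξ : GL (Fin d) ℝ) * g⁻¹, (conjSection g s ξ).2⟩ : H) =
        s (act (transposeGL g)⁻¹ ξ) := by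
      ext1
      simp [conjSection, mul_assoc]
    rw [h1, hO.dualAct_section _ hξ, act_act_inv]
  section_dualAct h := by
    ext1
    simp only [conjSection]
    rw [dualAct_conjGroup, act_inv_act, hO.section_dualAct]
    simp [mul_assoc]
  continuousOn := by
    have h1 : ContinuousOn (fun ξ => (s (act (transposeGL g)⁻¹ ξ) : GL (Fin d) ℝ))
        (act (transposeGL g)⁻¹ ⁻¹' O) :=
      continuous_subtype_val.comp_continuousOn
        (hO.continuousOn.comp (continuous_act _).continuousOn fun _ h => h)
    exact Topology.IsInducing.subtypeVal.continuousOn_iff.2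
      ((continuousOn_const.mul h1).mul continuousOn_const)

end Conjugation

/-! ### Powers of the determinant as weights -/

section Weights

variable {d : ℕ} {H : Subgroup (GL (Fin d) ℝ)}

lemma continuous_absDet_rpow (r : ℝ) :
    Continuous fun h : H => absDet (h : GL (Fin d) ℝ) ^ r :=
  Continuous.rpow_const (by fun_prop) fun _ => Or.inl (absDet_pos _).ne'

/-- Powers of the determinant are moderate with respect to themselves. -/
lemma isModerate_absDet_rpow (r : ℝ) :
    IsModerate H (fun h => absDet (h : GL (Fin d) ℝ) ^ r)
      (fun h => absDet (h : GL (Fin d) ℝ) ^ r) where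
  pos h := Real.rpow_pos_of_pos (absDet_pos _) _
  measurable := (continuous_absDet_rpow r).measurable
  bounded_on_compact K hK := by
    obtain ⟨C, hC⟩ := (hK.image (continuous_absDet_rpow r)).bddAbove
    exact ⟨C, fun h hh => hC (Set.mem_image_of_mem _ hh)⟩
  submultiplicative h k := by
    rw [Subgroup.coe_mul, absDet_mul, Real.mul_rpow (absDet_pos _).le (absDet_pos _).le]
  moderate a h b := by
    simp only [Subgroup.coe_mul, absDet_mul]
    rw [Real.mul_rpow (mul_pos (absDet_pos _) (absDet_pos _)).le (absDet_pos _).le,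
      Real.mul_rpow (absDet_pos _).le (absDet_pos _).le]

lemma conjWeight_shearletWeight (g : GL (Fin 2) ℝ) :
    conjWeight shearletGroup g shearletWeight =
      fun h : conjGroup shearletGroup g => absDet (h : GL (Fin 2) ℝ) ^ (7 / 6 : ℝ) := by
  funext h
  simp only [conjWeight, shearletWeight, absDet_mul, absDet_inv]
  rw [mul_right_comm, mul_inv_cancel₀ (absDet_pos g).ne', one_mul]

end Weights

/-! ### The dual orbit of the shearlet group -/

section Shearlet

/-- The matrix in the shearlet group with first row `ξ`. -/
def shearletMatrix (ξ : E 2) (hξ : ξ 0 ≠ 0) : GL (Fin 2) ℝ where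
  val := !![ξ 0, ξ 1; 0, ξ 0 / √|ξ 0|]
  inv := !![(ξ 0)⁻¹, -(ξ 1 * √|ξ 0| / ξ 0 ^ 2); 0, √|ξ 0| / ξ 0]
  val_inv := by
    have h1 : √|ξ 0| ≠ 0 := (Real.sqrt_pos.2 (abs_pos.2 hξ)).ne'
    ext i j
    fin_cases i <;> fin_cases j <;> simp [Matrix.mul_apply, Fin.sum_univ_two] <;> field_simp
    ring
  inv_val := by
    have h1 : √|ξ 0| ≠ 0 := (Real.sqrt_pos.2 (abs_pos.2 hξ)).ne'
    ext i j
    fin_cases i <;> fin_cases j <;> simp [Matrix.mul_apply, Fin.sum_univ_two] <;> field_simp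
    ring

lemma shearletMatrix_mem (ξ : E 2) (hξ : ξ 0 ≠ 0) : shearletMatrix ξ hξ ∈ shearletGroup := by
  have h0 := abs_pos.2 hξ
  have h1 := Real.sqrt_pos.2 h0
  rw [mem_shearletGroup_iff]
  refine ⟨by simp [shearletMatrix], ?_⟩
  simp only [shearletMatrix, Matrix.of_apply, Matrix.cons_val', Matrix.cons_val_zero,
    Matrix.cons_val_one, Matrix.cons_val_fin_one]
  rw [abs_div, abs_of_pos h1, div_mul_div_comm, Real.mul_self_sqrt h0.le,
    mul_div_cancel_right₀ _ h0.ne']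

open Classical in
/-- The inverse of the orbit map `h ↦ hᵀ (1, 0)` of the shearlet group. -/
def shearletSection (ξ : E 2) : shearletGroup :=
  if hξ : ξ 0 ≠ 0 then ⟨shearletMatrix ξ hξ, shearletMatrix_mem ξ hξ⟩ else 1

lemma coe_shearletSection {ξ : E 2} (hξ : ξ 0 ≠ 0) :
    (shearletSection ξ : GL (Fin 2) ℝ) = shearletMatrix ξ hξ := by
  rw [shearletSection, dif_pos hξ]

lemma dualAct_shearlet (h : shearletGroup) :
    dualAct h (!₂[(1 : ℝ), 0] : E 2) =
      !₂[(h : GL (Fin 2) ℝ) 0 0, (h : GL (Fin 2) ℝ) 0 1] := by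
  rw [dualAct, act_apply, coe_transposeGL]
  ext i
  fin_cases i <;> simp [Matrix.mulVec, dotProduct, Fin.sum_univ_two]

lemma shearlet_apply_ne_zero (h : shearletGroup) : (h : GL (Fin 2) ℝ) 0 0 ≠ 0 := by
  obtain ⟨h10, -⟩ := (mem_shearletGroup_iff _).1 h.2
  have h1 := absDet_pos (h : GL (Fin 2) ℝ)
  intro h0
  rw [absDet, Matrix.det_fin_two, h10, h0] at h1
  simp at h1

lemma measure_coordinate_zero : volume {ξ : E 2 | ξ 0 ≠ 0}ᶜ = 0 := by
  have h1 : {ξ : E 2 | ξ 0 ≠ 0}ᶜ =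
      (LinearMap.ker (EuclideanSpace.proj (0 : Fin 2) : E 2 →L[ℝ] ℝ).toLinearMap : Set (E 2)) := by
    ext ξ
    simp
  rw [h1]
  refine Measure.addHaar_submodule _ _ fun h2 => ?_
  have h3 : (!₂[(1 : ℝ), 0] : E 2) ∈
      LinearMap.ker (EuclideanSpace.proj (0 : Fin 2) : E 2 →L[ℝ] ℝ).toLinearMap := by
    rw [h2]; trivial
  simp at h3

lemma continuousOn_shearletSection : ContinuousOn shearletSection {ξ : E 2 | ξ 0 ≠ 0} := by
  rw [continuousOn_iff_continuous_domRestrict]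
  have h0 : ∀ i, Continuous fun ξ : {ξ : E 2 | ξ 0 ≠ 0} => (ξ : E 2) i := fun i => by fun_prop
  have h1 : ∀ ξ : {ξ : E 2 | ξ 0 ≠ 0}, √|(ξ : E 2) 0| ≠ 0 := fun ξ =>
    (Real.sqrt_pos.2 (abs_pos.2 ξ.2)).ne'
  have h2 : ∀ ξ : {ξ : E 2 | ξ 0 ≠ 0}, (ξ : E 2) 0 ≠ 0 := fun ξ => ξ.2
  have hsq : Continuous fun ξ : {ξ : E 2 | ξ 0 ≠ 0} => √|(ξ : E 2) 0| := (h0 0).abs.sqrt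
  refine continuous_induced_rng.2 (Units.continuous_iff.2 ⟨?_, ?_⟩)
  · have e1 : Continuous fun ξ : {ξ : E 2 | ξ 0 ≠ 0} =>
        (!![(ξ : E 2) 0, (ξ : E 2) 1; 0, (ξ : E 2) 0 / √|(ξ : E 2) 0|] :
          Matrix (Fin 2) (Fin 2) ℝ) := by
      refine continuous_matrix fun i j => ?_
      fin_cases i <;> fin_cases j
      · exact h0 0
      · exact h0 1
      · exact continuous_const
      · exact (h0 0).div hsq h1
    refine e1.congr fun ξ => ?_
    simp only [Function.comp_apply, Set.domRestrict_apply, coe_shearletSection (h2 ξ)]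
    rfl
  · have e1 : Continuous fun ξ : {ξ : E 2 | ξ 0 ≠ 0} =>
        (!![((ξ : E 2) 0)⁻¹, -((ξ : E 2) 1 * √|(ξ : E 2) 0| / (ξ : E 2) 0 ^ 2);
          0, √|(ξ : E 2) 0| / (ξ : E 2) 0] : Matrix (Fin 2) (Fin 2) ℝ) := by
      refine continuous_matrix fun i j => ?_
      fin_cases i <;> fin_cases j
      · exact (h0 0).inv₀ h2
      · exact (((h0 1).mul hsq).div ((h0 0).pow 2) fun ξ => pow_ne_zero 2 (h2 ξ)).neg
      · exact continuous_const
      · exact hsq.div (h0 0) h2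
    refine e1.congr fun ξ => ?_
    simp only [Function.comp_apply, Set.domRestrict_apply, coe_shearletSection (h2 ξ)]
    rfl

/-- `hᵀ(1, 0)` is the first row of `h`, and it determines `h`: the relation `h 0 0 = h 1 1 * |h 1
1|` recovers the last entry, sign included, from any nonzero `h 0 0`. -/
theorem isFreeOpenOrbit_shearlet :
    IsFreeOpenOrbit shearletGroup !₂[(1 : ℝ), 0] {ξ : E 2 | ξ 0 ≠ 0} shearletSection where
  isOpen := isOpen_ne_fun (by fun_prop) continuous_const
  conull := measure_coordinate_zero
  mem h := by
    rw [dualAct_shearlet]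
    exact shearlet_apply_ne_zero h
  dualAct_section ξ hξ := by
    rw [dualAct_shearlet, coe_shearletSection hξ]
    ext i
    fin_cases i <;> simp [shearletMatrix]
  section_dualAct h := by
    have h0 : (dualAct h (!₂[(1 : ℝ), 0] : E 2)) 0 ≠ 0 := by
      rw [dualAct_shearlet]
      exact shearlet_apply_ne_zero h
    obtain ⟨h10, h00⟩ := (mem_shearletGroup_iff _).1 h.2
    have h1 := shearlet_apply_ne_zero h
    have h11 : (h : GL (Fin 2) ℝ) 1 1 ≠ 0 := by
      intro h2
      rw [h2, zero_mul] at h00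
      exact h1 h00
    ext1
    rw [coe_shearletSection h0]
    ext i j
    fin_cases i <;> fin_cases j <;> simp [shearletMatrix, dualAct_shearlet, h10]
    rw [h00, abs_mul, abs_abs, Real.sqrt_mul_self (abs_nonneg _),
      mul_div_cancel_right₀ _ (abs_ne_zero.2 h11)]
  continuousOn := continuousOn_shearletSection

/-- The determinant equals `ξ 0 * √(ξ 0)`; this cruder bound already shows that it tends to zero at
the blind spot. -/
lemma absDet_shearletSection_le {ξ : E 2} (h0 : 0 < ξ 0) (h1 : ξ 0 ≤ 1) :
    absDet (shearletSection ξ : GL (Fin 2) ℝ) ≤ ξ 0 := by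
  rw [coe_shearletSection h0.ne', absDet]
  have h2 : (shearletMatrix ξ h0.ne' : Matrix (Fin 2) (Fin 2) ℝ) =
    !![ξ 0, ξ 1; 0, ξ 0 / √|ξ 0|] := rfl
  rw [h2, Matrix.det_fin_two_of, mul_zero, sub_zero, abs_of_pos h0, Real.div_sqrt, abs_of_nonneg
    (by positivity)]
  exact mul_le_of_le_one_right h0.le (Real.sqrt_le_one.2 h1)

end Shearlet

/-! ### The rotation and its effect on frequency supports -/

section Rotation

lemma transposeGL_rot : (transposeGL rot)⁻¹ = rot := by
  refine inv_eq_of_mul_eq_one_right ?_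
  ext i j
  fin_cases i <;> fin_cases j <;>
    simp [coe_transposeGL, rot, Matrix.mul_apply, Fin.sum_univ_two,
      Matrix.GeneralLinearGroup.mkOfDetNeZero]

lemma act_rot (ξ : E 2) : act rot ξ = !₂[-ξ 1, ξ 0] := by
  rw [act_apply]
  ext i
  fin_cases i <;>
    simp [rot, Matrix.mulVec, dotProduct, Fin.sum_univ_two,
      Matrix.GeneralLinearGroup.mkOfDetNeZero]

variable {d : ℕ}

lemma IsBandlimited.mono {O O' : Set (E d)} {η : 𝓢(E d, ℂ)} (hη : IsBandlimited O η)
    (h : O ⊆ O') : IsBandlimited O' η :=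
  ⟨hη.hasCompactSupport, hη.tsupport_subset.trans h⟩

/-- The quasi-regular representation moves the frequency support by the dual action. -/
lemma IsBandlimited.quasiRegularSchwartz {O : Set (E d)} {η : 𝓢(E d, ℂ)}
    (hη : IsBandlimited O η) (x : E d) (g : GL (Fin d) ℝ) :
    IsBandlimited (act (transposeGL g) ⁻¹' O) (quasiRegularSchwartz x g η) := by
  have h1 : Function.support (𝓕 (Coorbit.quasiRegularSchwartz x g η) : 𝓢(E d, ℂ)) ⊆
      act (transposeGL g) ⁻¹' tsupport (𝓕 η : 𝓢(E d, ℂ)) := by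
    intro ξ hξ
    by_contra hcon
    refine hξ ?_
    have h2 : 𝓕 (η : E d → ℂ) (act (transposeGL g) ξ) = 0 := image_eq_zero_of_notMem_tsupport hcon
    rw [SchwartzMap.fourier_coe, coe_quasiRegularSchwartz, fourier_quasiRegularFun, h2, smul_zero,
      mul_zero]
  have h3 : IsCompact (act (transposeGL g) ⁻¹' tsupport (𝓕 η : 𝓢(E d, ℂ))) :=
    (actHomeomorph (transposeGL g)).isCompact_preimage.2 hη.hasCompactSupport.isCompact
  exact ⟨HasCompactSupport.of_support_subset_isCompact h3 h1,
    (closure_minimal h1 h3.isClosed).trans (Set.preimage_mono hη.tsupport_subset)⟩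

end Rotation

/-! ### The bump across the blind spot -/

section Bump

lemma exists_isBumpAtBlindSpot : ∃ φ : E 2 → ℝ, IsBumpAtBlindSpot φ := by
  let f : ContDiffBump (!₂[(0 : ℝ), 3] : E 2) := ⟨1 / 2, 3 / 4, by norm_num, by norm_num⟩
  refine ⟨f, f.contDiff, f.hasCompactSupport, ?_, fun ξ => f.nonneg, fun ξ hξ => ?_⟩
  · rw [f.tsupport_eq]
    exact Metric.closedBall_subset_ball (by norm_num)
  · exact f.one_of_mem_closedBall (Metric.ball_subset_closedBall hξ)

variable {φ : E 2 → ℝ}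

/-- The Schwartz function with a given smooth compactly supported Fourier transform. -/
def IsBumpAtBlindSpot.inverse (hφ : IsBumpAtBlindSpot φ) : 𝓢(E 2, ℂ) :=
  𝓕⁻ (HasCompactSupport.toSchwartzMap (f := fun ξ => (φ ξ : ℂ))
    (hφ.compact_support.comp_left Complex.ofReal_zero)
    (Complex.ofRealCLM.contDiff.comp hφ.smooth))

lemma IsBumpAtBlindSpot.fourier_inverse (hφ : IsBumpAtBlindSpot φ) (ξ : E 2) :
    (𝓕 hφ.inverse : 𝓢(E 2, ℂ)) ξ = (φ ξ : ℂ) := by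
  rw [inverse, fourier_fourierInv_eq]
  rfl

lemma IsBumpAtBlindSpot.isBandlimited (hφ : IsBumpAtBlindSpot φ) :
    IsBandlimited {ξ : E 2 | ξ 1 ≠ 0} hφ.inverse := by
  have h1 : ⇑(𝓕 hφ.inverse : 𝓢(E 2, ℂ)) = fun ξ => (φ ξ : ℂ) := funext hφ.fourier_inverse
  refine ⟨?_, ?_⟩
  · rw [h1]
    exact hφ.compact_support.comp_left Complex.ofReal_zero
  · rw [h1]
    have h4 : Function.support (fun ξ => (φ ξ : ℂ)) ⊆ Function.support φ := fun ξ hξ => by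
      simpa using hξ
    refine (closure_mono h4).trans (hφ.support_subset.trans fun ξ hξ => ?_)
    -- Points of the unit ball around `(0, 3)` have second coordinate within distance one of `3`,
    -- hence nonzero.
    have h2 := PiLp.norm_apply_le (ξ - !₂[(0 : ℝ), 3]) 1
    rw [mem_ball_iff_norm] at hξ
    have h3 := h2.trans_lt hξ
    intro h0
    simp [h0] at h3

lemma IsBumpAtBlindSpot.exists_small (hφ : IsBumpAtBlindSpot φ) {ε : ℝ} (hε : 0 < ε) :
    ∃ ξ ∈ {ξ : E 2 | ξ 0 ≠ 0}, (𝓕 hφ.inverse : 𝓢(E 2, ℂ)) ξ = 1 ∧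
      absDet (shearletSection ξ : GL (Fin 2) ℝ) < ε := by
  -- The bound `1/4` keeps `(t, 3)` in the ball where `φ` is one; the bound `ε/2` makes the
  -- determinant smaller than `ε`.
  set t : ℝ := min (ε / 2) (1 / 4) with ht
  have ht0 : 0 < t := lt_min (by linarith) (by norm_num)
  have ht1 : t ≤ 1 / 4 := min_le_right _ _
  have ht2 : t ≤ ε / 2 := min_le_left _ _
  refine ⟨!₂[t, 3], by simpa using ht0.ne', ?_, ?_⟩
  · rw [hφ.fourier_inverse, hφ.eq_one, Complex.ofReal_one]
    rw [mem_ball_iff_norm]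
    have h1 : (!₂[t, 3] : E 2) - !₂[(0 : ℝ), 3] = !₂[t, 0] := by
      ext i; fin_cases i <;> simp
    rw [h1, EuclideanSpace.norm_eq]
    simp [Fin.sum_univ_two, Real.sqrt_sq_eq_abs, abs_of_pos ht0]
    linarith
  · have h1 := absDet_shearletSection_le (ξ := !₂[t, 3]) (by simpa using ht0)
      (by simp; linarith)
    refine h1.trans_lt ?_
    simp
    linarith

instance nontrivial_L2 : Nontrivial (L2 2) := by
  obtain ⟨φ, hφ⟩ := exists_isBumpAtBlindSpot
  refine ⟨toL2 hφ.inverse, 0, fun h0 => ?_⟩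
  have h1 : hφ.inverse = 0 := SchwartzMap.injective_toLp 2 volume (h0.trans toL2_zero.symm)
  obtain ⟨ξ, -, h2, -⟩ := hφ.exists_small one_pos
  have h3 : (𝓕 (0 : 𝓢(E 2, ℂ)) : 𝓢(E 2, ℂ)) = 0 := fourier_zero
  rw [h1, h3] at h2
  simp at h2

end Bump

/-! ### The shearlet group and its rotated copy compared -/

lemma preimage_act_rot : act (transposeGL rot)⁻¹ ⁻¹' {ξ : E 2 | ξ 0 ≠ 0} = {ξ : E 2 | ξ 1 ≠ 0} := by
  ext ξ
  simp [transposeGL_rot, act_rot]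

theorem isFreeOpenOrbit_conj_shearlet :
    IsFreeOpenOrbit (conjGroup shearletGroup rot) (act (transposeGL rot) !₂[(1 : ℝ), 0])
      {ξ : E 2 | ξ 1 ≠ 0} (conjSection rot shearletSection) := by
  rw [← preimage_act_rot]
  exact isFreeOpenOrbit_shearlet.conj rot

theorem IsBumpAtBlindSpot.not_memCoorbit {φ : E 2 → ℝ} (hφ : IsBumpAtBlindSpot φ)
    {v₀ : shearletGroup → ℝ} (hv : IsModerate shearletGroup shearletWeight v₀) {χ : L2 2}
    (hχ : χ ∈ analyzingVectors shearletGroup (controlWeight shearletGroup v₀)) (hχ0 : χ ≠ 0) :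
    ¬ MemCoorbit shearletGroup shearletWeight (controlWeight shearletGroup v₀) χ
      (toL2 hφ.inverse) :=
  isFreeOpenOrbit_shearlet.not_memCoorbit (r := 7 / 6) (by norm_num) (fun _ => rfl) hv hχ hχ0
    fun _ hε => hφ.exists_small hε

theorem IsBumpAtBlindSpot.memCoorbit_conj {φ : E 2 → ℝ} (hφ : IsBumpAtBlindSpot φ)
    {v₀ : conjGroup shearletGroup rot → ℝ} (hv : IsModerate (conjGroup shearletGroup rot)
      (conjWeight shearletGroup rot shearletWeight) v₀) {χ : L2 2}
    (hχ : χ ∈ analyzingVectors (conjGroup shearletGroup rot)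
      (controlWeight (conjGroup shearletGroup rot) v₀)) (hχ0 : χ ≠ 0) :
    MemCoorbit (conjGroup shearletGroup rot) (conjWeight shearletGroup rot shearletWeight)
      (controlWeight (conjGroup shearletGroup rot) v₀) χ (toL2 hφ.inverse) := by
  refine isFreeOpenOrbit_conj_shearlet.memCoorbit hv ?_ ?_ hχ hχ0 hφ.isBandlimited
  · intro h
    rw [conjWeight_shearletWeight]
    exact Real.rpow_nonneg (absDet_pos _).le _
  · rw [conjWeight_shearletWeight]
    exact continuous_absDet_rpow _

/-- The Fourier transform of the rotated function at `ξ` is `φ` at `(-ξ 1, ξ 0)`, up to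
normalization, so its support avoids `ξ 0 = 0`. -/
theorem IsBumpAtBlindSpot.memCoorbit_rotated {φ : E 2 → ℝ} (hφ : IsBumpAtBlindSpot φ)
    {v₀ : shearletGroup → ℝ} (hv : IsModerate shearletGroup shearletWeight v₀) {χ : L2 2}
    (hχ : χ ∈ analyzingVectors shearletGroup (controlWeight shearletGroup v₀)) (hχ0 : χ ≠ 0) :
    MemCoorbit shearletGroup shearletWeight (controlWeight shearletGroup v₀) χ
      (toL2 (quasiRegularSchwartz 0 rot⁻¹ hφ.inverse)) := by
  refine isFreeOpenOrbit_shearlet.memCoorbit hv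
    (fun h => Real.rpow_nonneg (absDet_pos _).le _) (continuous_absDet_rpow _) hχ hχ0 ?_
  refine (hφ.isBandlimited.quasiRegularSchwartz 0 rot⁻¹).mono fun ξ hξ => ?_
  rw [Set.mem_preimage, transposeGL_inv, transposeGL_rot, act_rot] at hξ
  simpa using hξ

end Coorbit

end

open Coorbit
theorem mainTheorem11 :
    (∃ φ : E 2 → ℝ, IsBumpAtBlindSpot φ) ∧
    (∀ φ : E 2 → ℝ, IsBumpAtBlindSpot φ →
      ∃ ψ : 𝓢(E 2, ℂ), (∀ ξ, 𝓕 (ψ : E 2 → ℂ) ξ = (φ ξ : ℂ)) ∧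
        (∀ v₀ : conjGroup shearletGroup rot → ℝ,
          IsModerate (conjGroup shearletGroup rot)
            (conjWeight shearletGroup rot shearletWeight) v₀ →
          ∀ χ ∈ analyzingVectors (conjGroup shearletGroup rot)
              (controlWeight (conjGroup shearletGroup rot) v₀), χ ≠ 0 →
            MemCoorbit (conjGroup shearletGroup rot)
              (conjWeight shearletGroup rot shearletWeight)
              (controlWeight (conjGroup shearletGroup rot) v₀) χ (ψ.toLp 2)) ∧
        (∀ v₀ : shearletGroup → ℝ, IsModerate shearletGroup shearletWeight v₀ →
          ∀ χ ∈ analyzingVectors shearletGroup (controlWeight shearletGroup v₀), χ ≠ 0 →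
            ¬ MemCoorbit shearletGroup shearletWeight
              (controlWeight shearletGroup v₀) χ (ψ.toLp 2))) ∧
    (∀ v₀ : shearletGroup → ℝ, IsModerate shearletGroup shearletWeight v₀ →
      ∀ χ ∈ analyzingVectors shearletGroup (controlWeight shearletGroup v₀), χ ≠ 0 →
        ¬ ∀ f : L2 2,
          MemCoorbit shearletGroup shearletWeight (controlWeight shearletGroup v₀) χ f →
          MemCoorbit shearletGroup shearletWeight (controlWeight shearletGroup v₀) χ
            (quasiRegular 0 rot f)) ∧
    (∃ v₀ : shearletGroup → ℝ, IsModerate shearletGroup shearletWeight v₀) ∧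
    (∀ v₀ : shearletGroup → ℝ, IsModerate shearletGroup shearletWeight v₀ →
      ∃ χ ∈ analyzingVectors shearletGroup (controlWeight shearletGroup v₀), χ ≠ 0) ∧
    (∃ v₀ : conjGroup shearletGroup rot → ℝ, IsModerate (conjGroup shearletGroup rot)
      (conjWeight shearletGroup rot shearletWeight) v₀) ∧
    (∀ v₀ : conjGroup shearletGroup rot → ℝ, IsModerate (conjGroup shearletGroup rot)
        (conjWeight shearletGroup rot shearletWeight) v₀ →
      ∃ χ ∈ analyzingVectors (conjGroup shearletGroup rot)
        (controlWeight (conjGroup shearletGroup rot) v₀), χ ≠ 0) := by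
  refine ⟨exists_isBumpAtBlindSpot, fun φ hφ => ⟨hφ.inverse, fun ξ => ?_, ?_, ?_⟩, ?_, ?_, ?_,
    ?_, ?_⟩
  · exact hφ.fourier_inverse ξ
  · intro v₀ hv χ hχ hχ0
    exact hφ.memCoorbit_conj hv hχ hχ0
  · intro v₀ hv χ hχ hχ0
    exact hφ.not_memCoorbit hv hχ hχ0
  · intro v₀ hv χ hχ hχ0 hinv
    obtain ⟨φ, hφ⟩ := exists_isBumpAtBlindSpot
    -- The rotation carries this member of the space back to the function with Fourier transform
    -- `φ`, which lies outside it.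
    have h1 := hinv _ (hφ.memCoorbit_rotated hv hχ hχ0)
    rw [← quasiRegular_toL2, quasiRegular_quasiRegular, act_zero, add_zero, mul_inv_cancel,
      quasiRegular_zero_one] at h1
    exact hφ.not_memCoorbit hv hχ hχ0 h1
  · exact ⟨_, isModerate_absDet_rpow _⟩
  · exact fun v₀ hv => isFreeOpenOrbit_shearlet.exists_analyzing_ne_zero hv
  · rw [conjWeight_shearletWeight]
    exact ⟨_, isModerate_absDet_rpow _⟩
  · exact fun v₀ hv => isFreeOpenOrbit_conj_shearlet.exists_analyzing_ne_zero hv
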